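/- **Problem.** Let $f:\mathbb{R}^{n_1}\to\mathbb{R}$, $\theta:\mathbb{R}^{n_2}\to\mathbb{R}$ be $C^1$, let $E,F,C,D$ be real matrices, $d\in\mathbb{R}^m$, and let $l<v$ and $s<r$ (componentwise), where the entries of $l,s$ lie in $\mathbb{R}\cup\{-\infty\}$ and those of $v,r$ in $\mathbb{R}\cup\{+\infty\}$. Consider $$\min\ f(x)+\theta(y)\quad\text{s.t.}\quad Ex+Fy-d\le 0,\quad l\le Cx\le v,\quad s\le Dy\le r .\qquad(1)$$ Write $u=(x,y)$, $F_0(u)=f(x)+\theta(y)$, $h(u)=Ex+Fy-d$, $\mathcal F_+$ for the feasible set, and $\|z\|_Q^2=z^\top Qz$; $\|\cdot\|$ is the Euclidean norm. The multipliers are $\mu\ge0$ for $Ex+Fy-d\le0$, $\alpha^x,\gamma^x\ge0$ for $l\le Cx$, $Cx\le v$, and $\alpha^y,\gamma^y\ge0$ for $s\le Dy$, $Dy\le r$; multipliers of infinite bounds are zero. **Method.** The parameters are $\rho,\sigma\in(0,1)$, $\tau_1>0$, $c\in[0,1]$, $M,M_1>0$; the start is $u_0\in\mathcal F_+$. At iteration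 $k$, with symmetric positive definite $H_k^x,H_k^y$ and $h_k=h(u_k)$: 1. Compute the optimal solutions $\tilde x,\tilde y$ of $$\min\ \nabla f(x_k)^\top(x-x_k)+\tfrac12\|x-x_k\|^2_{H_k^x}\ \text{ s.t. } Ex+Fy_k-d\le\tfrac c2h_k,\ l\le Cx\le v,$$ $$\min\ \nabla\theta(y_k)^\top(y-y_k)+\tfrac12\|y-y_k\|^2_{H_k^y}\ \text{ s.t. } Ex_k+Fy-d\le\tfrac c2h_k,\ s\le Dy\le r,$$ with KKT multipliers $(\mu_k^x,\alpha_k^x,\gamma_k^x)$ and $(\mu_k^y,\alpha_k^y,\gamma_k^y)$, and set $d_k=(\tilde x-x_k,\tilde y-y_k)$. 2. If $\min\{\|\mu_k^x\|,\|\mu_k^y\|\}\le M$ and $\|\mu_k^x-\mu_k^y\|\le M_1\|d_k\|^{\tau_1}$, keep these and set $c_{\max}=1/(2-c)$. Otherwise replace $(\tilde x,\tilde y)$ by the optimal solution (with KKT multipliers) of the joint problem of minimizing the sum of the two quadratic objectives over $(x,y)\in\mathcal F_+$, set again $d_k=(\tilde x-x_k,\tilde y-y_k)$, and set $c_{\max}=1$.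 3. Let $t_k$ be the largest $t\in\{c_{\max}\sigma^i:i=0,1,2,\dots\}$ with $F_0(u_k+td_k)\le F_0(u_k)-\rho t\|d_k\|^2_{H_k}$, where $H_k=\mathrm{diag}(H_k^x,H_k^y)$. Set $u_{k+1}=u_k+t_kd_k$; stop if $u_{k+1}=u_k$, otherwise choose new symmetric positive definite $H_{k+1}^x,H_{k+1}^y$ and continue. The final $(\tilde x,\tilde y)$ of iteration $k$ is denoted $\tilde u_{k+1}=(\tilde x_{k+1},\tilde y_{k+1})$. For index sets $S,I,J$ of rows of $(E\ F)$, $C$, $D$, let $\mathcal B(S,I,J)$ be the matrix with rows $(E_S\ F_S)$, $(C_I\ 0)$, $(0\ D_J)$. Let $S_u$, $I_x$, $J_y$ be the sets of indices of constraints active at $u=(x,y)$ (for $I_x$, $J_y$: lower or upper bound active). **Theorem.** Let $c=1$, $\rho\in(0,\tfrac12)$, $\tau_1>1$, and let the method generate an infinite sequence $\{u_k\}$. Assume: - *(uniform positive definiteness)* there is $\eta>0$ with $H_k\succeq\eta I$ for all $k$, and $\{H_k\}_{k\in K}$ is bounded whenever $\{u_k\}_{k\in K}$ is bounded; - *(LICQ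 and SSOSC)* $f$ and $\theta$ are $C^2$ in a neighborhood of $\mathcal F_+$; $\{u_k\}$ is bounded and has an accumulation point $u_*=(x_*,y_*)$ at which $\mathcal B(S_{u_*},I_{x_*},J_{y_*})$ has full row rank and, with the KKT multiplier $(\mu_*,\alpha_*^x,\gamma_*^x,\alpha_*^y,\gamma_*^y)$ of (1) at $u_*$, $z^\top\nabla^2F_0(u_*)z>0$ for every $z\ne0$ with $\mathcal B(S_*^+,I_*^+,J_*^+)z=0$, where $S_*^+,I_*^+,J_*^+$ are the sets of indices of the constraints that are active at $u_*$ with a positive multiplier; - *(Dennis–Moré-type condition)* either $\|(H_k-\nabla^2F_0(u_k))d_k\|=o(\|d_k\|)$; or $\|P_k(H_k-\nabla^2F_0(u_k))d_k\|=o(\|d_k\|)$ and strict complementarity holds at $u_*$, i.e. every inequality active at $u_*$ has a positive multiplier. Here $P_k=I-\mathcal B_k^\top(\mathcal B_k\mathcal B_k^\top)^{-1}\mathcal B_k$ and $\mathcal B_k=\mathcal B(S_k^+,I_{\tilde x_{k+1}},J_{\tilde y_{k+1}})$, where $S_k^+=S_{\tilde u_{k+1}}$ if $\tilde u_{k+1}$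 comes from the joint problem, and otherwise $S_k^+$ is the set of $i$ with $(E\tilde x_{k+1}+Fy_k-d-\tfrac12h_k)_i=0$ and $(Ex_k+F\tilde y_{k+1}-d-\tfrac12h_k)_i=0$. Then $u_k\to u_*$ superlinearly, i.e. $\|u_{k+1}-u_*\|=o(\|u_k-u_*\|)$. -/

import Mathlib

open Filter Topology Matrix

/-- The Euclidean space `ℝⁿ` (with the `ℓ₂` norm). -/
abbrev Vec (n : ℕ) : Type := EuclideanSpace ℝ (Fin n)

/-- The stacked vector `u = (x, y) ∈ ℝ^(n₁ + n₂)`, with the `ℓ₂` norm. -/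
noncomputable def pair {n₁ n₂ : ℕ} (x : Vec n₁) (y : Vec n₂) :
    EuclideanSpace ℝ (Fin n₁ ⊕ Fin n₂) :=
  WithLp.toLp 2 (Sum.elim x.ofLp y.ofLp)

/-- The quadratic form `‖z‖²_Q = zᵀ Q z`. -/
def quadForm {ι : Type} [Fintype ι] (Q : Matrix ι ι ℝ) (z : ι → ℝ) : ℝ :=
  z ⬝ᵥ (Q *ᵥ z)

/-- The Hessian matrix of a function on `ℝⁿ`. -/
noncomputable def hess {n : ℕ} (g : Vec n → ℝ) (x : Vec n) : Matrix (Fin n) (Fin n) ℝ :=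
  Matrix.of fun i j =>
    fderiv ℝ (fderiv ℝ g) x (EuclideanSpace.single i 1) (EuclideanSpace.single j 1)

/-- `0 ≤ μ ⊥ s ≥ 0`. -/
def ComplZero {p : ℕ} (μ s : Fin p → ℝ) : Prop :=
  ∀ i, 0 ≤ μ i ∧ 0 ≤ s i ∧ μ i * s i = 0

/-- `l ≤ z ≤ v` for extended-real bounds. -/
def InBox {p : ℕ} (l v : Fin p → EReal) (z : Fin p → ℝ) : Prop :=
  ∀ i, l i ≤ (z i : EReal) ∧ (z i : EReal) ≤ v i

/-- `0 ≤ α ⊥ (z - l) ≥ 0` and `0 ≤ γ ⊥ (v - z) ≥ 0`; with the convention that `a * (±∞) = 0`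
only if `a = 0`, the multiplier of an infinite bound is zero. -/
def BoxCompl {p : ℕ} (l v : Fin p → EReal) (z α γ : Fin p → ℝ) : Prop :=
  InBox l v z ∧ ∀ i,
    0 ≤ α i ∧ 0 ≤ γ i ∧
    (α i = 0 ∨ (z i : EReal) = l i) ∧ (γ i = 0 ∨ (z i : EReal) = v i)

/-- The two-block problem without equality constraint:
minimize `f x + θ y` subject to `E x + F y - d ≤ 0`, `l ≤ C x ≤ v`, `s ≤ D y ≤ r`,
where `f`, `θ` are `C¹`, the entries of `l`, `s` lie in `ℝ ∪ {-∞}`,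
those of `v`, `r` in `ℝ ∪ {+∞}`, and `l < v`, `s < r` componentwise. -/
structure Problem (n₁ n₂ m l₁ l₂ : ℕ) where
  f : Vec n₁ → ℝ
  θ : Vec n₂ → ℝ
  E : Matrix (Fin m) (Fin n₁) ℝ
  F : Matrix (Fin m) (Fin n₂) ℝ
  d : Fin m → ℝ
  C : Matrix (Fin l₁) (Fin n₁) ℝ
  D : Matrix (Fin l₂) (Fin n₂) ℝ
  l : Fin l₁ → EReal
  v : Fin l₁ → EReal
  s : Fin l₂ → EReal
  r : Fin l₂ → EReal
  f_smooth : ContDiff ℝ 1 f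
  θ_smooth : ContDiff ℝ 1 θ
  l_ne_top : ∀ i, l i ≠ ⊤
  v_ne_bot : ∀ i, v i ≠ ⊥
  s_ne_top : ∀ j, s j ≠ ⊤
  r_ne_bot : ∀ j, r j ≠ ⊥
  l_lt_v : ∀ i, l i < v i
  s_lt_r : ∀ j, s j < r j

/-- Lagrange multipliers of the inequality constraints of the problem. -/
structure Multipliers (m l₁ l₂ : ℕ) where
  μ : Fin m → ℝ
  αx : Fin l₁ → ℝ
  γx : Fin l₁ → ℝ
  αy : Fin l₂ → ℝ
  γy : Fin l₂ → ℝ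

/-- A candidate `(x̃, ỹ)` for the next point, together with multipliers of the
quadratic subproblem(s) that generate it. -/
structure QOData (n₁ n₂ m l₁ l₂ : ℕ) where
  x : Vec n₁
  y : Vec n₂
  μx : Vec m
  μy : Vec m
  αx : Fin l₁ → ℝ
  γx : Fin l₁ → ℝ
  αy : Fin l₂ → ℝ
  γy : Fin l₂ → ℝ

/-- The parameters of the method (those attached to the equality constraint do not occur). -/
structure Params where
  ρ : ℝ
  τ₁ : ℝ
  c : ℝ
  σ : ℝ
  M : ℝ
  M₁ : ℝ
  ρ_mem : ρ ∈ Set.Ioo (0 : ℝ) 1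
  τ₁_pos : 0 < τ₁
  c_mem : c ∈ Set.Icc (0 : ℝ) 1
  σ_mem : σ ∈ Set.Ioo (0 : ℝ) 1
  M_pos : 0 < M
  M₁_pos : 0 < M₁

namespace Problem

variable {n₁ n₂ m l₁ l₂ : ℕ} (P : Problem n₁ n₂ m l₁ l₂)

/-- The constraint function `E x + F y - d`. -/
def h (x : Vec n₁) (y : Vec n₂) : Fin m → ℝ :=
  P.E *ᵥ x.ofLp + P.F *ᵥ y.ofLp - P.d

/-- The feasible set. -/
def feasible : Set (Vec n₁ × Vec n₂) :=
  {u | (∀ i, P.h u.1 u.2 i ≤ 0) ∧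
    InBox P.l P.v (P.C *ᵥ u.1.ofLp) ∧ InBox P.s P.r (P.D *ᵥ u.2.ofLp)}

/-- The objective function, which is also the merit function. -/
def obj (x : Vec n₁) (y : Vec n₂) : ℝ := P.f x + P.θ y

/-- The Hessian matrix of the objective function at `(x, y)`. -/
noncomputable def hessObj (x : Vec n₁) (y : Vec n₂) :
    Matrix (Fin n₁ ⊕ Fin n₂) (Fin n₁ ⊕ Fin n₂) ℝ :=
  Matrix.fromBlocks (hess P.f x) 0 0 (hess P.θ y)

/-- `(x, y)` with the multipliers `Λ` is a primal-dual KKT solution of the problem. -/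
def IsKKT (x : Vec n₁) (y : Vec n₂) (Λ : Multipliers m l₁ l₂) : Prop :=
  (gradient P.f x).ofLp + P.Eᵀ *ᵥ Λ.μ + P.Cᵀ *ᵥ (Λ.γx - Λ.αx) = 0 ∧
  (gradient P.θ y).ofLp + P.Fᵀ *ᵥ Λ.μ + P.Dᵀ *ᵥ (Λ.γy - Λ.αy) = 0 ∧
  ComplZero Λ.μ (-P.h x y) ∧
  BoxCompl P.l P.v (P.C *ᵥ x.ofLp) Λ.αx Λ.γx ∧
  BoxCompl P.s P.r (P.D *ᵥ y.ofLp) Λ.αy Λ.γy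

/-! ### The quadratic subproblems at the current point `(x, y)` -/

/-- Objective of the `x`-subproblem, with `H` in the role of the Hessian of `f`. -/
noncomputable def qx (x : Vec n₁) (H : Matrix (Fin n₁) (Fin n₁) ℝ) (x' : Vec n₁) : ℝ :=
  (gradient P.f x).ofLp ⬝ᵥ (x' - x).ofLp + 1 / 2 * quadForm H (x' - x).ofLp

/-- Objective of the `y`-subproblem, with `H` in the role of the Hessian of `θ`. -/
noncomputable def qy (y : Vec n₂) (H : Matrix (Fin n₂) (Fin n₂) ℝ) (y' : Vec n₂) : ℝ :=
  (gradient P.θ y).ofLp ⬝ᵥ (y' - y).ofLp + 1 / 2 * quadForm H (y' - y).ofLp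

/-- Feasible set of the `x`-subproblem: `E x' + F y - d ≤ (c / 2) h(x, y)`, `l ≤ C x' ≤ v`. -/
def xFeasible (c : ℝ) (x : Vec n₁) (y : Vec n₂) : Set (Vec n₁) :=
  {x' | (∀ i, P.h x' y i ≤ c / 2 * P.h x y i) ∧ InBox P.l P.v (P.C *ᵥ x'.ofLp)}

/-- Feasible set of the `y`-subproblem: `E x + F y' - d ≤ (c / 2) h(x, y)`, `s ≤ D y' ≤ r`. -/
def yFeasible (c : ℝ) (x : Vec n₁) (y : Vec n₂) : Set (Vec n₂) :=
  {y' | (∀ i, P.h x y' i ≤ c / 2 * P.h x y i) ∧ InBox P.s P.r (P.D *ᵥ y'.ofLp)}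

/-- `q` consists of the optimal solutions of the `x`- and the `y`-subproblem with
corresponding KKT multipliers `(μx, αx, γx)` and `(μy, αy, γy)`. -/
def SolvesSplit (c : ℝ) (x : Vec n₁) (y : Vec n₂)
    (Hx : Matrix (Fin n₁) (Fin n₁) ℝ) (Hy : Matrix (Fin n₂) (Fin n₂) ℝ)
    (q : QOData n₁ n₂ m l₁ l₂) : Prop :=
  (q.x ∈ P.xFeasible c x y ∧ IsMinOn (P.qx x Hx) (P.xFeasible c x y) q.x) ∧
  (q.y ∈ P.yFeasible c x y ∧ IsMinOn (P.qy y Hy) (P.yFeasible c x y) q.y) ∧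
  (gradient P.f x).ofLp + Hx *ᵥ (q.x - x).ofLp
    + P.Eᵀ *ᵥ q.μx.ofLp + P.Cᵀ *ᵥ (q.γx - q.αx) = 0 ∧
  ComplZero q.μx.ofLp ((c / 2) • P.h x y - P.h q.x y) ∧
  BoxCompl P.l P.v (P.C *ᵥ q.x.ofLp) q.αx q.γx ∧
  (gradient P.θ y).ofLp + Hy *ᵥ (q.y - y).ofLp
    + P.Fᵀ *ᵥ q.μy.ofLp + P.Dᵀ *ᵥ (q.γy - q.αy) = 0 ∧
  ComplZero q.μy.ofLp ((c / 2) • P.h x y - P.h x q.y) ∧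
  BoxCompl P.s P.r (P.D *ᵥ q.y.ofLp) q.αy q.γy

/-- `q` consists of the optimal solution of the joint `(x, y)`-subproblem (whose feasible set is
that of the problem itself) with corresponding KKT multipliers, where `μx = μy = μ`. -/
def SolvesJoint (x : Vec n₁) (y : Vec n₂)
    (Hx : Matrix (Fin n₁) (Fin n₁) ℝ) (Hy : Matrix (Fin n₂) (Fin n₂) ℝ)
    (q : QOData n₁ n₂ m l₁ l₂) : Prop :=
  ((q.x, q.y) ∈ P.feasible ∧
    IsMinOn (fun u => P.qx x Hx u.1 + P.qy y Hy u.2) P.feasible (q.x, q.y)) ∧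
  q.μx = q.μy ∧
  (gradient P.f x).ofLp + Hx *ᵥ (q.x - x).ofLp
    + P.Eᵀ *ᵥ q.μx.ofLp + P.Cᵀ *ᵥ (q.γx - q.αx) = 0 ∧
  (gradient P.θ y).ofLp + Hy *ᵥ (q.y - y).ofLp
    + P.Fᵀ *ᵥ q.μx.ofLp + P.Dᵀ *ᵥ (q.γy - q.αy) = 0 ∧
  ComplZero q.μx.ofLp (-P.h q.x q.y) ∧
  BoxCompl P.l P.v (P.C *ᵥ q.x.ofLp) q.αx q.γx ∧
  BoxCompl P.s P.r (P.D *ᵥ q.y.ofLp) q.αy q.γy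

/-! ### Active sets and constraint qualifications -/

open Classical in
/-- Active indices of the coupling constraint `E x + F y - d ≤ 0`. -/
noncomputable def actS (x : Vec n₁) (y : Vec n₂) : Finset (Fin m) :=
  Finset.univ.filter fun i => P.h x y i = 0

open Classical in
/-- Active indices of `l ≤ C x ≤ v`. -/
noncomputable def actI (x : Vec n₁) : Finset (Fin l₁) :=
  Finset.univ.filter fun i =>
    ((P.C *ᵥ x.ofLp) i : EReal) = P.l i ∨ ((P.C *ᵥ x.ofLp) i : EReal) = P.v i

open Classical in
/-- Active indices of `s ≤ D y ≤ r`. -/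
noncomputable def actJ (y : Vec n₂) : Finset (Fin l₂) :=
  Finset.univ.filter fun j =>
    ((P.D *ᵥ y.ofLp) j : EReal) = P.s j ∨ ((P.D *ᵥ y.ofLp) j : EReal) = P.r j

open Classical in
/-- Active indices of the coupling constraint with positive multiplier. -/
noncomputable def actSPos (x : Vec n₁) (y : Vec n₂) (Λ : Multipliers m l₁ l₂) :
    Finset (Fin m) :=
  Finset.univ.filter fun i => P.h x y i = 0 ∧ 0 < Λ.μ i

open Classical in
/-- Active indices of `l ≤ C x ≤ v` with positive multiplier. -/
noncomputable def actIPos (x : Vec n₁) (Λ : Multipliers m l₁ l₂) : Finset (Fin l₁) :=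
  Finset.univ.filter fun i =>
    (((P.C *ᵥ x.ofLp) i : EReal) = P.l i ∧ 0 < Λ.αx i) ∨
    (((P.C *ᵥ x.ofLp) i : EReal) = P.v i ∧ 0 < Λ.γx i)

open Classical in
/-- Active indices of `s ≤ D y ≤ r` with positive multiplier. -/
noncomputable def actJPos (y : Vec n₂) (Λ : Multipliers m l₁ l₂) : Finset (Fin l₂) :=
  Finset.univ.filter fun j =>
    (((P.D *ᵥ y.ofLp) j : EReal) = P.s j ∧ 0 < Λ.αy j) ∨
    (((P.D *ᵥ y.ofLp) j : EReal) = P.r j ∧ 0 < Λ.γy j)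

/-- The constraint matrix with rows `(E_S F_S)`, `(C_I 0)`, `(0 D_J)`. -/
def rowsMatrix (S : Finset (Fin m)) (I : Finset (Fin l₁)) (J : Finset (Fin l₂)) :
    Matrix (S ⊕ (I ⊕ J)) (Fin n₁ ⊕ Fin n₂) ℝ :=
  Matrix.fromRows
    (Matrix.fromCols (P.E.submatrix (fun i : S => (i : Fin m)) id)
      (P.F.submatrix (fun i : S => (i : Fin m)) id))
    (Matrix.fromBlocks (P.C.submatrix (fun i : I => (i : Fin l₁)) id) 0 0
      (P.D.submatrix (fun j : J => (j : Fin l₂)) id))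

/-- LICQ at `(x, y)`: the matrix of the active constraints has full row rank. -/
def LICQ (x : Vec n₁) (y : Vec n₂) : Prop :=
  LinearIndependent ℝ (fun i => P.rowsMatrix (P.actS x y) (P.actI x) (P.actJ y) i)

/-- Strong second-order sufficient condition at `(x, y)` with the multipliers `Λ`. -/
def SSOSC (x : Vec n₁) (y : Vec n₂) (Λ : Multipliers m l₁ l₂) : Prop :=
  ∀ z : Fin n₁ ⊕ Fin n₂ → ℝ, z ≠ 0 →
    P.rowsMatrix (P.actSPos x y Λ) (P.actIPos x Λ) (P.actJPos y Λ) *ᵥ z = 0 →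
    0 < quadForm (P.hessObj x y) z

/-- Strict complementarity at `(x, y)`: multipliers of active constraints are positive. -/
def StrictCompl (x : Vec n₁) (y : Vec n₂) (Λ : Multipliers m l₁ l₂) : Prop :=
  (∀ i, P.h x y i = 0 → 0 < Λ.μ i) ∧
  (∀ i, ((P.C *ᵥ x.ofLp) i : EReal) = P.l i → 0 < Λ.αx i) ∧
  (∀ i, ((P.C *ᵥ x.ofLp) i : EReal) = P.v i → 0 < Λ.γx i) ∧
  (∀ j, ((P.D *ᵥ y.ofLp) j : EReal) = P.s j → 0 < Λ.αy j) ∧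
  (∀ j, ((P.D *ᵥ y.ofLp) j : EReal) = P.r j → 0 < Λ.γy j)

/-- `f` and `θ` are twice continuously differentiable near the feasible set. -/
def C2NearFeasible : Prop :=
  ∃ U : Set (Vec n₁ × Vec n₂), IsOpen U ∧ P.feasible ⊆ U ∧
    ContDiffOn ℝ 2 P.f (Prod.fst '' U) ∧ ContDiffOn ℝ 2 P.θ (Prod.snd '' U)

end Problem

/-! ### The method -/

/-- The recognition criterion for a solution `q` of the split subproblems at `(x, y)`. -/
def Params.Accepts {n₁ n₂ m l₁ l₂ : ℕ} (p : Params) (x : Vec n₁) (y : Vec n₂)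
    (q : QOData n₁ n₂ m l₁ l₂) : Prop :=
  min ‖q.μx‖ ‖q.μy‖ ≤ p.M ∧ ‖q.μx - q.μy‖ ≤ p.M₁ * ‖pair (q.x - x) (q.y - y)‖ ^ p.τ₁

open Classical in
/-- An infinite run of the distributed SQO method. At iteration `k`, `trial k` is the outcome of
the split subproblems; `sol k` is `trial k` if the recognition criterion accepts it, and the
outcome of the joint subproblem otherwise. The direction is `(x̃, ỹ) - (x, y)`, and `t k` is the
Armijo step size. -/
structure Run {n₁ n₂ m l₁ l₂ : ℕ} (P : Problem n₁ n₂ m l₁ l₂) (p : Params) where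
  x : ℕ → Vec n₁
  y : ℕ → Vec n₂
  Hx : ℕ → Matrix (Fin n₁) (Fin n₁) ℝ
  Hy : ℕ → Matrix (Fin n₂) (Fin n₂) ℝ
  trial : ℕ → QOData n₁ n₂ m l₁ l₂
  sol : ℕ → QOData n₁ n₂ m l₁ l₂
  t : ℕ → ℝ
  init_feasible : (x 0, y 0) ∈ P.feasible
  Hx_posDef : ∀ k, (Hx k).PosDef
  Hy_posDef : ∀ k, (Hy k).PosDef
  trial_spec : ∀ k, P.SolvesSplit p.c (x k) (y k) (Hx k) (Hy k) (trial k)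
  sol_of_accepts : ∀ k, p.Accepts (x k) (y k) (trial k) → sol k = trial k
  sol_of_not_accepts : ∀ k, ¬ p.Accepts (x k) (y k) (trial k) →
    P.SolvesJoint (x k) (y k) (Hx k) (Hy k) (sol k)
  step_spec : ∀ k, IsGreatest
    {t : ℝ | (∃ i : ℕ,
        t = (if p.Accepts (x k) (y k) (trial k) then 1 / (2 - p.c) else 1) * p.σ ^ i) ∧
      P.obj (x k + t • ((sol k).x - x k)) (y k + t • ((sol k).y - y k)) ≤
        P.obj (x k) (y k) - p.ρ * t *
          (quadForm (Hx k) ((sol k).x - x k).ofLp + quadForm (Hy k) ((sol k).y - y k).ofLp)}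
    (t k)
  x_succ : ∀ k, x (k + 1) = x k + t k • ((sol k).x - x k)
  y_succ : ∀ k, y (k + 1) = y k + t k • ((sol k).y - y k)
  no_stop : ∀ k, (x (k + 1), y (k + 1)) ≠ (x k, y k)

namespace Run

variable {n₁ n₂ m l₁ l₂ : ℕ} {P : Problem n₁ n₂ m l₁ l₂} {p : Params} (R : Run P p)

/-- The iterates `u_k = (x_k, y_k)`. -/
noncomputable def u (k : ℕ) : EuclideanSpace ℝ (Fin n₁ ⊕ Fin n₂) := pair (R.x k) (R.y k)

/-- The search directions `d_k = (x̃_{k+1} - x_k, ỹ_{k+1} - y_k)`. -/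
noncomputable def dir (k : ℕ) : EuclideanSpace ℝ (Fin n₁ ⊕ Fin n₂) :=
  pair ((R.sol k).x - R.x k) ((R.sol k).y - R.y k)

/-- The block diagonal matrix with blocks `Hx_k`, `Hy_k`. -/
def H (k : ℕ) : Matrix (Fin n₁ ⊕ Fin n₂) (Fin n₁ ⊕ Fin n₂) ℝ :=
  Matrix.fromBlocks (R.Hx k) 0 0 (R.Hy k)

/-- The matrices are uniformly positive definite, and bounded along every bounded
subsequence of iterates. -/
def UniformlyPosDef : Prop :=
  (∃ η : ℝ, 0 < η ∧
    ∀ k, (R.H k - η • (1 : Matrix (Fin n₁ ⊕ Fin n₂) (Fin n₁ ⊕ Fin n₂) ℝ)).PosSemidef) ∧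
  ∀ K : Set ℕ, Bornology.IsBounded (R.u '' K) → ∃ B : ℝ, ∀ k ∈ K, ∀ i j, |R.H k i j| ≤ B

open Classical in
/-- The working set of the coupling constraint at iteration `k`: the constraints that are active
in both split subproblems, or in the joint one, according to which of them generated the step. -/
noncomputable def workS (k : ℕ) : Finset (Fin m) :=
  if p.Accepts (R.x k) (R.y k) (R.trial k) then
    Finset.univ.filter fun i =>
      P.h (R.sol k).x (R.y k) i - p.c / 2 * P.h (R.x k) (R.y k) i = 0 ∧
      P.h (R.x k) (R.sol k).y i - p.c / 2 * P.h (R.x k) (R.y k) i = 0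
  else P.actS (R.sol k).x (R.sol k).y

/-- The matrix `B_k` of working constraints at iteration `k`. -/
noncomputable def B (k : ℕ) :
    Matrix (R.workS k ⊕ (P.actI (R.sol k).x ⊕ P.actJ (R.sol k).y)) (Fin n₁ ⊕ Fin n₂) ℝ :=
  P.rowsMatrix (R.workS k) (P.actI (R.sol k).x) (P.actJ (R.sol k).y)

open Classical in
/-- The projection matrix `P_k = I - B_kᵀ (B_k B_kᵀ)⁻¹ B_k`. -/
noncomputable def proj (k : ℕ) : Matrix (Fin n₁ ⊕ Fin n₂) (Fin n₁ ⊕ Fin n₂) ℝ :=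
  1 - (R.B k)ᵀ * (R.B k * (R.B k)ᵀ)⁻¹ * R.B k

/-- The error `(H_k - ∇²(f + θ)(u_k)) d_k` of the Hessian approximation along the direction. -/
noncomputable def hessErr (k : ℕ) : Fin n₁ ⊕ Fin n₂ → ℝ :=
  (R.H k - P.hessObj (R.x k) (R.y k)) *ᵥ (R.dir k).ofLp

/-- The Dennis-Moré-type condition at `(xs, ys)`: either the error of the Hessian approximation
is `o(‖d_k‖)`, or its projection is and strict complementarity holds at `(xs, ys)`. -/
def DennisMore (xs : Vec n₁) (ys : Vec n₂) : Prop :=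
  (fun k => WithLp.toLp 2 (R.hessErr k)) =o[atTop] R.dir ∨
  ((fun k => WithLp.toLp 2 (R.proj k *ᵥ R.hessErr k)) =o[atTop] R.dir ∧
    ∀ Λ, P.IsKKT xs ys Λ → P.StrictCompl xs ys Λ)

end Run

/-! Stacking `(x, y)` turns the problem into the minimization of one function `Φ` under two-sided
linear constraints `L i ≤ ⟪a i, u⟫ ≤ U i`, with one signed multiplier per row. With `c = 1` the
method becomes a feasible SQP method with inexact multipliers. Since `h` is affine, the two
half-relaxed coupling constraints add up to `h ≤ 0` at the joint trial point. The componentwise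
minimum of the two coupling multipliers is complementary there, and the stationarity error it causes
is `O(‖μx - μy‖) = O(‖d‖ ^ τ₁) = o(‖d‖)`. Both kinds of subproblem start the line search at step
one.

Global convergence: the Armijo rule forces `d → 0`. LICQ makes the multipliers converge along a
subsequence tending to `u_*`, so `u_*` is a KKT point. The second-order condition gives quadratic
growth there (`BoxKKT.quadratic_growth`), and since steps become short the whole sequence is trapped
(`tendsto_of_growth`).

Local rate: write `(H_k - ∇²Φ(u_*)) d_k = p_k + ∑ c_i a_i` with `p_k = o(‖d_k‖)`, where eventually
`c` is supported on rows with nonzero limit multiplier. Those rows are eventually tight at the trial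
point, hence orthogonal to `w = u_k + d_k - u_*`. Pairing the difference of the KKT systems at the
trial point and at `u_*` with `w` removes the `c`-terms, and the multiplier terms have a favourable
sign by monotonicity. Coercivity of the Hessian on the remaining directions gives `w = o(‖d_k‖)`
(`trial_isLittleO`). Since `c → 0` by LICQ, the multiplier terms absorb the `c`-terms in the Armijo
test, and `ρ < 1/2` admits the unit step (`eventually_unit_step`). -/

/-! ### Two-sided linear constraints, signed multipliers, Finsler's lemma -/

section BoxConstraints

variable {V : Type*} [NormedAddCommGroup V] [InnerProductSpace ℝ V] {ι : Type*}

/-- `u` satisfies the two-sided linear constraints `L i ≤ ⟪a i, u⟫ ≤ U i`. -/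
def BoxFeasible (a : ι → V) (L U : ι → EReal) (u : V) : Prop :=
  ∀ i, L i ≤ ((inner ℝ (a i) u : ℝ) : EReal) ∧ ((inner ℝ (a i) u : ℝ) : EReal) ≤ U i

/-- The constraint `i` is active at `u`. -/
def BoxActive (a : ι → V) (L U : ι → EReal) (u : V) (i : ι) : Prop :=
  ((inner ℝ (a i) u : ℝ) : EReal) = L i ∨ ((inner ℝ (a i) u : ℝ) : EReal) = U i

/-- The signed multipliers `lam` are complementary to the two-sided constraints at `u`. -/
def BoxNormal (a : ι → V) (L U : ι → EReal) (u : V) (lam : ι → ℝ) : Prop :=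
  ∀ i, (0 < lam i → ((inner ℝ (a i) u : ℝ) : EReal) = U i) ∧
    (lam i < 0 → ((inner ℝ (a i) u : ℝ) : EReal) = L i)

/-- `u` with the signed multipliers `lam` satisfies the KKT conditions of minimizing a function
with gradient `G` under the two-sided constraints. -/
def BoxKKT [Fintype ι] (a : ι → V) (L U : ι → EReal) (G : V → V) (u : V) (lam : ι → ℝ) : Prop :=
  BoxFeasible a L U u ∧ G u + ∑ i, lam i • a i = 0 ∧ BoxNormal a L U u lam

variable {a : ι → V} {L U : ι → EReal}

/-- A nonzero multiplier pins `u` to the bound selected by its sign, and a feasible `v` can only lie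
on the other side. This is the normal cone inequality behind every monotonicity argument below. -/
theorem BoxNormal.mul_nonneg {u v : V} {lam : ι → ℝ} (h : BoxNormal a L U u lam)
    (hv : BoxFeasible a L U v) (i : ι) : 0 ≤ lam i * inner ℝ (a i) (u - v) := by
  rw [inner_sub_right]
  rcases lt_trichotomy (lam i) 0 with hl | hl | hl
  · have h1 := (hv i).1
    rw [← (h i).2 hl, EReal.coe_le_coe_iff] at h1
    nlinarith
  · simp [hl]
  · have h1 := (hv i).2
    rw [← (h i).1 hl, EReal.coe_le_coe_iff] at h1
    nlinarith

theorem BoxNormal.active {u : V} {lam : ι → ℝ} (h : BoxNormal a L U u lam) {i : ι}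
    (hi : lam i ≠ 0) : BoxActive a L U u i := by
  rcases lt_or_gt_of_ne hi with hl | hl
  · exact Or.inl ((h i).2 hl)
  · exact Or.inr ((h i).1 hl)

/-- The value on the segment lies between the minimum and the maximum of the end values, each of
which is one of the end values; extended-real arithmetic with infinite bounds is thereby avoided. -/
theorem BoxFeasible.lineSegment {u d : V} {t : ℝ} (hu : BoxFeasible a L U u)
    (hd : BoxFeasible a L U (u + d)) (ht0 : 0 ≤ t) (ht1 : t ≤ 1) :
    BoxFeasible a L U (u + t • d) := by
  intro i
  have e : inner ℝ (a i) (u + t • d) =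
      (1 - t) * inner ℝ (a i) u + t * inner ℝ (a i) (u + d) := by
    simp only [inner_add_right, inner_smul_right]; ring
  set p : ℝ := inner ℝ (a i) u
  set q : ℝ := inner ℝ (a i) (u + d)
  have h1 : min p q ≤ (1 - t) * p + t * q := by
    nlinarith [min_le_left p q, min_le_right p q]
  have h2 : (1 - t) * p + t * q ≤ max p q := by
    nlinarith [le_max_left p q, le_max_right p q]
  rw [e]
  constructor
  · refine le_trans ?_ (EReal.coe_le_coe_iff.2 h1)
    rcases min_choice p q with h | h <;> rw [h]
    exacts [(hu i).1, (hd i).1]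
  · refine le_trans (EReal.coe_le_coe_iff.2 h2) ?_
    rcases max_choice p q with h | h <;> rw [h]
    exacts [(hu i).2, (hd i).2]

theorem tendsto_coe_inner {α : Type*} {l : Filter α} {w : α → V} {us : V}
    (h : Tendsto w l (𝓝 us)) (i : ι) :
    Tendsto (fun k => ((inner ℝ (a i) (w k) : ℝ) : EReal)) l
      (𝓝 ((inner ℝ (a i) us : ℝ) : EReal)) :=
  (continuous_coe_real_ereal.tendsto _).comp
    (((continuous_const.inner continuous_id).tendsto us).comp h)

theorem BoxFeasible.of_tendsto {α : Type*} {l : Filter α} [NeBot l] {w : α → V} {us : V}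
    (h : Tendsto w l (𝓝 us)) (hw : ∀ k, BoxFeasible a L U (w k)) : BoxFeasible a L U us :=
  fun i => ⟨ge_of_tendsto (tendsto_coe_inner h i) (Eventually.of_forall fun k => (hw k i).1),
    le_of_tendsto (tendsto_coe_inner h i) (Eventually.of_forall fun k => (hw k i).2)⟩

/-- Constraints active near `us` are active at `us`. -/
theorem eventually_active_imp [Finite ι] {α : Type*} {l : Filter α} {w : α → V} {us : V}
    (h : Tendsto w l (𝓝 us)) :
    ∀ᶠ k in l, ∀ i, BoxActive a L U (w k) i → BoxActive a L U us i := by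
  rw [eventually_all]
  intro i
  by_cases hi : BoxActive a L U us i
  · exact Eventually.of_forall fun _ _ => hi
  · rw [BoxActive, not_or] at hi
    filter_upwards [(tendsto_coe_inner h i).eventually_ne hi.1,
      (tendsto_coe_inner h i).eventually_ne hi.2] with k h1 h2 h3
    exact (h3.elim h1 h2).elim

/-- Coefficients of convergent linear combinations of linearly independent vectors converge. -/
theorem exists_tendsto_coefficients [Fintype ι] {α : Type*} {l : Filter α} [NeBot l]
    {A : ι → Prop} (hli : LinearIndependent ℝ (fun i : {i // A i} => a i))
    {c : α → ι → ℝ} {v : V} (hv : Tendsto (fun k => ∑ i, c k i • a i) l (𝓝 v))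
    (hc : ∀ᶠ k in l, ∀ i, c k i ≠ 0 → A i) :
    ∃ cs, Tendsto c l (𝓝 cs) ∧ ∑ i, cs i • a i = v ∧ (v = 0 → cs = 0) := by
  classical
  let T := Fintype.linearCombination ℝ (fun i : {i // A i} => a i)
  have hT : LinearMap.ker T = ⊥ := by
    rw [LinearMap.ker_eq_bot]
    exact hli.fintypeLinearCombination_injective
  -- An injective linear map from a finite-dimensional space is a closed embedding: the limit stays
  -- in the range, and convergence of images forces convergence of coefficients.
  have hemb := LinearMap.isClosedEmbedding_of_injective hT
  have hrestr : ∀ b : ι → ℝ, (∀ i, b i ≠ 0 → A i) → ∑ i, b i • a i = T (fun i => b i) := by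
    intro b hb
    rw [Fintype.linearCombination_apply,
      ← Finset.sum_filter_add_sum_filter_not Finset.univ (fun i => A i),
      Finset.sum_eq_zero (s := Finset.univ.filter fun i => ¬ A i), add_zero]
    · exact Finset.sum_subtype _ (by simp) _
    · intro i hi
      by_cases h : b i = 0
      · simp [h]
      · exact absurd (hb i h) (Finset.mem_filter.1 hi).2
  have hmap : Tendsto (fun k => T (fun i => c k i)) l (𝓝 v) := by
    refine hv.congr' ?_
    filter_upwards [hc] with k hk
    rw [hrestr _ hk]
  obtain ⟨b, hb⟩ : v ∈ Set.range T :=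
    hemb.isClosed_range.mem_of_tendsto hmap (Eventually.of_forall fun k => ⟨_, rfl⟩)
  have hconv : Tendsto (fun k => fun i : {i // A i} => c k i) l (𝓝 b) := by
    rw [← hb] at hmap
    exact hemb.isInducing.tendsto_nhds_iff.2 hmap
  have htend : Tendsto c l (𝓝 fun i => if h : A i then b ⟨i, h⟩ else 0) := by
    rw [tendsto_pi_nhds] at hconv ⊢
    intro i
    by_cases h : A i
    · simpa [h] using hconv ⟨i, h⟩
    · simp only [h, dif_neg, not_false_eq_true]
      refine tendsto_const_nhds.congr' ?_
      filter_upwards [hc] with k hk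
      by_contra h'
      exact h (hk i (Ne.symm h'))
  refine ⟨_, htend, tendsto_nhds_unique
    (tendsto_finsetSum _ fun i _ => (tendsto_pi_nhds.1 htend i).smul_const _) hv, fun h0 => ?_⟩
  have hb0 : b = 0 := hli.fintypeLinearCombination_injective (by rw [map_zero]; exact hb.trans h0)
  funext i
  simp [hb0]

/-- Along a filter on which the trial points `w` converge to `us`, multipliers whose stationarity
residual vanishes converge to KKT multipliers at `us`, provided LICQ holds there. -/
theorem exists_tendsto_multipliers [Fintype ι] {α : Type*} {l : Filter α} [NeBot l] {us : V}
    {G : V → V} {w v : α → V} {lam : α → ι → ℝ}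
    (hw : Tendsto w l (𝓝 us)) (hfeas : ∀ k, BoxFeasible a L U (w k))
    (hv : Tendsto v l (𝓝 (-G us)))
    (hlam : ∀ k, ∑ i, lam k i • a i = v k) (hnorm : ∀ k, BoxNormal a L U (w k) (lam k))
    (hli : LinearIndependent ℝ (fun i : {i // BoxActive a L U us i} => a i)) :
    ∃ lams, Tendsto lam l (𝓝 lams) ∧ BoxKKT a L U G us lams := by
  obtain ⟨lams, htend, hsum, -⟩ := exists_tendsto_coefficients hli (c := lam) (l := l)
    (v := -G us) (by simpa only [hlam] using hv) (by
      filter_upwards [eventually_active_imp (a := a) (L := L) (U := U) hw] with k hk i hi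
      exact hk i ((hnorm k).active hi))
  refine ⟨lams, htend, BoxFeasible.of_tendsto hw hfeas, by rw [hsum, add_neg_cancel], fun i => ?_⟩
  have h1 := tendsto_pi_nhds.1 htend i
  constructor <;> intro hi
  -- A limit multiplier with a strict sign has that sign eventually, so the bound is attained along
  -- the filter and hence in the limit.
  · refine tendsto_nhds_unique_of_eventuallyEq (tendsto_coe_inner hw i) tendsto_const_nhds ?_
    filter_upwards [h1.eventually_const_lt hi] with k hk using (hnorm k i).1 hk
  · refine tendsto_nhds_unique_of_eventuallyEq (tendsto_coe_inner hw i) tendsto_const_nhds ?_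
    filter_upwards [h1.eventually_lt_const hi] with k hk using (hnorm k i).2 hk

/-- Finsler's lemma: a quadratic form that is positive on the common kernel of finitely many
functionals becomes positive definite after adding a multiple of their squares. -/
theorem exists_finsler [FiniteDimensional ℝ V] (Q : V →L[ℝ] V) (T : Finset ι)
    (hpos : ∀ w, w ≠ 0 → (∀ i ∈ T, inner ℝ (a i) w = 0) → 0 < inner ℝ w (Q w)) :
    ∃ κ > 0, ∃ c ≥ (0 : ℝ), ∀ w,
      κ * ‖w‖ ^ 2 ≤ inner ℝ w (Q w) + c * ∑ i ∈ T, inner ℝ (a i) w ^ 2 := by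
  let q : ℕ → V → ℝ := fun n w => inner ℝ w (Q w) + n * ∑ i ∈ T, inner ℝ (a i) w ^ 2
  have hq : ∀ n, Continuous (q n) := by
    intro n
    have : ∀ i, Continuous fun w : V => inner ℝ (a i) w := fun i => by fun_prop
    fun_prop
  have hcpt : IsCompact (Metric.sphere (0 : V) 1) := isCompact_sphere 0 1
  -- The open sets where `q n` is positive increase with `n` and cover the unit sphere, so by
  -- compactness a single `n` serves all directions.
  obtain ⟨n, hn⟩ := hcpt.elim_directed_cover (fun n => {w | 0 < q n w})
    (fun n => isOpen_lt continuous_const (hq n)) (by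
      intro w hw
      have hw0 : w ≠ 0 := by
        rintro rfl; simp at hw
      rw [Set.mem_iUnion]
      by_cases h : ∀ i ∈ T, inner ℝ (a i) w = 0
      · exact ⟨0, by simpa [q] using hpos w hw0 h⟩
      · push Not at h
        obtain ⟨i, hi, hne⟩ := h
        have hs : 0 < ∑ i ∈ T, inner ℝ (a i) w ^ 2 :=
          Finset.sum_pos' (fun _ _ => sq_nonneg _) ⟨i, hi, by positivity⟩
        obtain ⟨n, hn⟩ := exists_nat_gt (-inner ℝ w (Q w) / ∑ i ∈ T, inner ℝ (a i) w ^ 2)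
        rw [div_lt_iff₀ hs] at hn
        exact ⟨n, by simp only [q, Set.mem_ofPred_eq]; linarith⟩)
    (by
      refine Monotone.directed_le fun n m hnm w hw => ?_
      simp only [Set.mem_ofPred_eq, q] at hw ⊢
      have hs : 0 ≤ ∑ i ∈ T, inner ℝ (a i) w ^ 2 := Finset.sum_nonneg fun _ _ => sq_nonneg _
      have : (n : ℝ) ≤ m := by exact_mod_cast hnm
      nlinarith)
  obtain ⟨κ, hκ, hmin⟩ : ∃ κ > 0, ∀ w ∈ Metric.sphere (0 : V) 1, κ ≤ q n w := by
    -- The sphere is empty when `V` is trivial; any positive `κ` then works.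
    rcases (Metric.sphere (0 : V) 1).eq_empty_or_nonempty with he | hne
    · exact ⟨1, one_pos, by simp [he]⟩
    · obtain ⟨w₀, hw₀, hm⟩ := hcpt.exists_isMinOn hne (hq n).continuousOn
      exact ⟨q n w₀, hn hw₀, fun w hw => hm hw⟩
  refine ⟨κ, hκ, n, n.cast_nonneg, fun w => ?_⟩
  rcases eq_or_ne w 0 with rfl | hw
  · simp
  have hnw : ‖w‖ ≠ 0 := norm_ne_zero_iff.2 hw
  have h1 := hmin (‖w‖⁻¹ • w) (by simp [norm_smul, hnw])
  simp only [q, map_smul, inner_smul_left, inner_smul_right, mul_pow, ← Finset.mul_sum] at h1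
  have h2 := mul_le_mul_of_nonneg_right h1 (sq_nonneg ‖w‖)
  refine h2.trans_eq ?_
  simp only [conj_trivial]
  field_simp

end BoxConstraints

/-! ### Second-order expansion -/

section SecondOrder

variable {V : Type*} [NormedAddCommGroup V] [InnerProductSpace ℝ V] [CompleteSpace V]

/-- Second-order expansion, uniform in the base point, from strict differentiability of the
gradient. -/
theorem eventually_taylor_two {Φ : V → ℝ} {G : V → V} {Q : V →L[ℝ] V} {us : V}
    (hG : ∀ u, HasGradientAt Φ (G u) u) (hQ : HasStrictFDerivAt G Q us) {ε : ℝ} (hε : 0 < ε) :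
    ∃ δ > 0, ∀ u ∈ Metric.ball us δ, ∀ v ∈ Metric.ball us δ,
      ‖G v - G u - Q (v - u)‖ ≤ ε * ‖v - u‖ ∧
      |Φ v - Φ u - inner ℝ (G u) (v - u) - 1 / 2 * inner ℝ (v - u) (Q (v - u))|
        ≤ ε * ‖v - u‖ ^ 2 := by
  have h1 := hQ.isLittleO.def hε
  rw [nhds_prod_eq, ((Metric.nhds_basis_ball (x := us)).prod_self).eventually_iff] at h1
  obtain ⟨δ, hδ, h1⟩ := h1
  have key : ∀ u ∈ Metric.ball us δ, ∀ v ∈ Metric.ball us δ,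
      ‖G v - G u - Q (v - u)‖ ≤ ε * ‖v - u‖ := fun u hu v hv =>
    h1 (x := (v, u)) ⟨hv, hu⟩
  refine ⟨δ, hδ, fun u hu v hv => ⟨key u hu v hv, ?_⟩⟩
  obtain ⟨w, hw⟩ : ∃ w, w = v - u := ⟨_, rfl⟩
  rw [← hw]
  -- Along the segment, `φ` is `Φ` minus its quadratic model, up to a constant. Its derivative is
  -- the gradient error paired with `w`, at most `ε * ‖w‖ ^ 2`, and the mean value inequality
  -- concludes.
  let φ : ℝ → ℝ := fun s => Φ (u + s • w) - s * inner ℝ (G u) w - s ^ 2 / 2 * inner ℝ w (Q w)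
  have hφ : ∀ s, HasDerivAt φ (inner ℝ (G (u + s • w)) w - inner ℝ (G u) w
      - s * inner ℝ w (Q w)) s := by
    intro s
    have e1 : HasDerivAt (fun s : ℝ => u + s • w) w s := by
      simpa using ((hasDerivAt_id s).smul_const w).const_add u
    have e2 := (hG (u + s • w)).hasFDerivAt.comp_hasDerivAt s e1
    have e3 := (hasDerivAt_id s).mul_const (inner ℝ (G u) w)
    have e4 := (((hasDerivAt_id s).pow 2).div_const 2).mul_const (inner ℝ w (Q w))
    have e5 := (e2.sub e3).sub e4
    refine HasDerivAt.congr_deriv (f := φ) e5 ?_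
    simp
  have hb : ∀ s ∈ Set.Ico (0 : ℝ) 1, ‖inner ℝ (G (u + s • w)) w - inner ℝ (G u) w
      - s * inner ℝ w (Q w)‖ ≤ ε * ‖w‖ ^ 2 := by
    intro s hs
    have hmem : u + s • w ∈ Metric.ball us δ := by
      have := (convex_ball us δ).add_smul_sub_mem hu hv ⟨hs.1, hs.2.le⟩
      rwa [← hw] at this
    have h2 := key u hu _ hmem
    simp only [add_sub_cancel_left, map_smul] at h2
    have e : inner ℝ (G (u + s • w)) w - inner ℝ (G u) w - s * inner ℝ w (Q w) =
        inner ℝ (G (u + s • w) - G u - s • Q w) w := by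
      rw [inner_sub_left, inner_sub_left, inner_smul_left, real_inner_comm w (Q w)]
      simp
    rw [e]
    refine (norm_inner_le_norm _ _).trans ?_
    rw [norm_smul, Real.norm_of_nonneg hs.1] at h2
    have : ε * (s * ‖w‖) ≤ ε * ‖w‖ := by
      have := mul_le_mul_of_nonneg_right hs.2.le (norm_nonneg w)
      nlinarith
    calc _ ≤ ε * ‖w‖ * ‖w‖ := by gcongr; exact h2.trans this
      _ = _ := by ring
  have h3 := norm_image_sub_le_of_norm_deriv_le_segment' (f := φ) (a := 0) (b := 1)
    (fun s _ => (hφ s).hasDerivWithinAt) hb 1 (by simp)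
  simp only [φ, Real.norm_eq_abs] at h3
  have e6 : u + (1 : ℝ) • w = v := by simp [hw]
  rw [e6] at h3
  rw [sub_zero, mul_one] at h3
  convert h3 using 2
  simp only [zero_smul, add_zero]
  ring

end SecondOrder

/-! ### Quadratic growth at a KKT point -/

section LocalTheory

variable {V : Type*} [NormedAddCommGroup V] [InnerProductSpace ℝ V] [FiniteDimensional ℝ V]
  {ι : Type*} [Fintype ι] {a : ι → V} {L U : ι → EReal} {Φ : V → ℝ} {G : V → V}

theorem hasDerivAt_comp_line (hG : ∀ u, HasGradientAt Φ (G u) u) (x w : V) (s : ℝ) :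
    HasDerivAt (fun s : ℝ => Φ (x + s • w)) (inner ℝ (G (x + s • w)) w) s := by
  have e1 : HasDerivAt (fun s : ℝ => x + s • w) w s := by
    simpa using ((hasDerivAt_id s).smul_const w).const_add x
  exact (hG (x + s • w)).hasFDerivAt.comp_hasDerivAt s e1

/-- By Finsler's lemma the Hessian form is coercive up to a penalty `c * ∑ ⟪a i, w⟫ ^ 2` over rows
with nonzero multiplier. By stationarity and feasibility, the first-order term equals `∑ |lam i| *
|⟪a i, w⟫|`; being linear in `w`, it dominates half of that quadratic penalty near `us`. -/
theorem BoxKKT.quadratic_growth {Q : V →L[ℝ] V} {us : V} {lam : ι → ℝ}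
    (hG : ∀ u, HasGradientAt Φ (G u) u) (hQ : HasStrictFDerivAt G Q us)
    (hK : BoxKKT a L U G us lam)
    (hS : ∀ w, w ≠ 0 → (∀ i, lam i ≠ 0 → inner ℝ (a i) w = 0) → 0 < inner ℝ w (Q w)) :
    ∃ κ > 0, ∃ δ > 0, ∀ u ∈ Metric.ball us δ, BoxFeasible a L U u →
      κ * ‖u - us‖ ^ 2 ≤ Φ u - Φ us := by
  classical
  obtain ⟨κ, hκ, c, hc, hfin⟩ := exists_finsler (a := a) Q (Finset.univ.filter fun i => lam i ≠ 0)
    (fun w hw h => hS w hw fun i hi => h i (by simp [hi]))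
  -- The factor `1 / 2` in the expansion leaves `κ / 2`; spending `κ / 4` on the remainder leaves
  -- growth `κ / 4`.
  obtain ⟨δ₁, hδ₁, htay⟩ := eventually_taylor_two hG hQ (ε := κ / 4) (by positivity)
  have hnear : ∀ᶠ u in 𝓝 us, ∀ i, lam i ≠ 0 → c * |inner ℝ (a i) (u - us)| ≤ |lam i| := by
    rw [eventually_all]
    intro i
    by_cases hi : lam i = 0
    · exact Eventually.of_forall fun u h => absurd hi h
    · have hcont : Continuous fun u : V => c * |inner ℝ (a i) (u - us)| := by fun_prop
      have h := hcont.tendsto us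
      simp only [sub_self, inner_zero_right, abs_zero, mul_zero] at h
      filter_upwards [h.eventually_lt_const (abs_pos.2 hi)] with u hu _ using hu.le
  obtain ⟨δ₂, hδ₂, hnear⟩ := Metric.eventually_nhds_iff_ball.1 hnear
  refine ⟨κ / 4, by positivity, min δ₁ δ₂, lt_min hδ₁ hδ₂, fun u hu hf => ?_⟩
  have h1 := (htay us (Metric.mem_ball_self hδ₁) u
    (Metric.ball_subset_ball (min_le_left _ _) hu)).2
  have h2 := hnear u (Metric.ball_subset_ball (min_le_right _ _) hu)
  set w := u - us with hw
  have h3 := hfin w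
  have h4 : inner ℝ (G us) w = ∑ i, -(lam i * inner ℝ (a i) w) := by
    have := congrArg (fun z => inner ℝ z w) hK.2.1
    simp only [inner_add_left, sum_inner, inner_smul_left, inner_zero_left, conj_trivial] at this
    rw [Finset.sum_neg_distrib]
    linarith
  have h5 : ∀ i, 0 ≤ -(lam i * inner ℝ (a i) w) := fun i => by
    have := hK.2.2.mul_nonneg hf i
    rw [← neg_sub, inner_neg_right] at this
    linarith
  have h6 : c / 2 * ∑ i ∈ Finset.univ.filter (fun i => lam i ≠ 0), inner ℝ (a i) w ^ 2
      ≤ inner ℝ (G us) w := by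
    rw [h4, Finset.mul_sum, ← Finset.sum_filter_add_sum_filter_not Finset.univ (fun i => lam i ≠ 0)]
    refine le_add_of_le_of_nonneg (Finset.sum_le_sum fun i hi => ?_)
      (Finset.sum_nonneg fun i _ => h5 i)
    have h7 := h2 i (Finset.mem_filter.1 hi).2
    have h8 : -(lam i * inner ℝ (a i) w) = |lam i| * |inner ℝ (a i) w| := by
      rw [← abs_mul, ← abs_neg, abs_of_nonneg (h5 i)]
    rw [h8, ← sq_abs]
    nlinarith [abs_nonneg (inner ℝ (a i) w), mul_nonneg hc (sq_nonneg |inner ℝ (a i) w|)]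
  have h9 := (abs_le.1 h1).1
  nlinarith

end LocalTheory

/-! ### The abstract method and its global convergence -/

/-- A sequence of iterates `u`, directions `d` and step sizes `t` generated by a feasible
sequential quadratic method with (inexact) multipliers `lam` and residuals `r` of higher order,
and Armijo line search. -/
structure BoxSQO {V : Type*} [NormedAddCommGroup V] [InnerProductSpace ℝ V]
    {ι : Type*} [Fintype ι] (a : ι → V) (L U : ι → EReal) (Φ : V → ℝ) (G : V → V) where
  u : ℕ → V
  d : ℕ → V
  H : ℕ → V →L[ℝ] V
  t : ℕ → ℝ
  lam : ℕ → ι → ℝ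
  r : ℕ → V
  ρ : ℝ
  σ : ℝ
  η : ℝ
  K : ℝ
  τ : ℝ
  ρ_pos : 0 < ρ
  ρ_lt : ρ < 1 / 2
  σ_pos : 0 < σ
  η_pos : 0 < η
  one_lt_τ : 1 < τ
  feasible_u : ∀ k, BoxFeasible a L U (u k)
  feasible_trial : ∀ k, BoxFeasible a L U (u k + d k)
  coercive : ∀ k z, η * ‖z‖ ^ 2 ≤ inner ℝ z (H k z)
  kkt : ∀ k, G (u k) + H k (d k) + ∑ i, lam k i • a i = r k
  normal : ∀ k, BoxNormal a L U (u k + d k) (lam k)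
  residual : ∀ k, ‖r k‖ ≤ K * ‖d k‖ ^ τ
  descent : ∀ k, inner ℝ (G (u k)) (d k) ≤ -inner ℝ (d k) (H k (d k))
  t_pos : ∀ k, 0 < t k
  t_le_one : ∀ k, t k ≤ 1
  armijo : ∀ k, Φ (u k + t k • d k) ≤ Φ (u k) - ρ * t k * inner ℝ (d k) (H k (d k))
  full_step : ∀ k, Φ (u k + d k) ≤ Φ (u k) - ρ * inner ℝ (d k) (H k (d k)) → t k = 1
  backtrack : ∀ k, t k ≠ 1 → t k / σ ≤ 1 ∧
    Φ (u k) - ρ * (t k / σ) * inner ℝ (d k) (H k (d k)) < Φ (u k + (t k / σ) • d k)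
  succ : ∀ k, u (k + 1) = u k + t k • d k
  bounded : Bornology.IsBounded (Set.range u)
  H_bounded : ∃ B, ∀ k, ‖H k‖ ≤ B

namespace BoxSQO

variable {V : Type*} [NormedAddCommGroup V] [InnerProductSpace ℝ V]
  {ι : Type*} [Fintype ι] {a : ι → V} {L U : ι → EReal} {Φ : V → ℝ} {G : V → V}
  (S : BoxSQO a L U Φ G)

theorem norm_dir_le (k : ℕ) : S.η * ‖S.d k‖ ≤ ‖G (S.u k)‖ := by
  rcases eq_or_ne (S.d k) 0 with h | h
  · simp [h]
  have h1 := S.coercive k (S.d k)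
  have h2 := S.descent k
  have h3 := (abs_le.1 (abs_real_inner_le_norm (G (S.u k)) (S.d k))).1
  have h4 : 0 < ‖S.d k‖ := norm_pos_iff.2 h
  nlinarith

theorem decrease (k : ℕ) : S.ρ * S.η * (S.t k * ‖S.d k‖ ^ 2) ≤ Φ (S.u k) - Φ (S.u (k + 1)) := by
  have h1 := S.armijo k
  rw [← S.succ] at h1
  have h2 := mul_le_mul_of_nonneg_left (S.coercive k (S.d k))
    (mul_nonneg S.ρ_pos.le (S.t_pos k).le)
  linarith

theorem antitone_obj : Antitone fun k => Φ (S.u k) := by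
  refine antitone_nat_of_succ_le fun k => ?_
  have h := S.decrease k
  have := mul_nonneg (mul_nonneg S.ρ_pos.le S.η_pos.le)
    (mul_nonneg (S.t_pos k).le (sq_nonneg ‖S.d k‖))
  linarith

/-- Split `‖d‖ ^ τ` as `‖d‖ ^ (τ - 1) * ‖d‖`; the first factor vanishes in the limit because `τ >
1`. -/
theorem tendsto_residual {l : Filter ℕ} (hd : Tendsto S.d l (𝓝 0)) : S.r =o[l] S.d := by
  rw [Asymptotics.isLittleO_iff]
  intro ε hε
  have h1 : Tendsto (fun k => S.K * ‖S.d k‖ ^ (S.τ - 1)) l (𝓝 0) := by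
    have h2 : Tendsto (fun k => ‖S.d k‖ ^ (S.τ - 1)) l (𝓝 (0 ^ (S.τ - 1))) := by
      have := hd.norm
      rw [norm_zero] at this
      exact this.rpow_const (Or.inr (by linarith [S.one_lt_τ]))
    rw [Real.zero_rpow (by linarith [S.one_lt_τ])] at h2
    simpa using h2.const_mul S.K
  filter_upwards [h1.eventually_lt_const hε] with k hk
  rcases eq_or_ne (S.d k) 0 with h | h
  · have := S.residual k
    rw [h, norm_zero, Real.zero_rpow (by linarith [S.one_lt_τ])] at this
    rw [h, norm_zero]
    simpa using this
  · have h3 := norm_pos_iff.2 h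
    refine (S.residual k).trans ?_
    have h4 : ‖S.d k‖ ^ S.τ = ‖S.d k‖ ^ (S.τ - 1) * ‖S.d k‖ := by
      rw [← Real.rpow_add_one h3.ne']; ring_nf
    rw [h4, ← mul_assoc]
    gcongr

theorem exists_tendsto_multipliers (hGc : Continuous G) {l : Filter ℕ} [NeBot l] {us : V}
    (hu : Tendsto S.u l (𝓝 us)) (hd : Tendsto S.d l (𝓝 0))
    (hli : LinearIndependent ℝ (fun i : {i // BoxActive a L U us i} => a i)) :
    ∃ lams, Tendsto S.lam l (𝓝 lams) ∧ BoxKKT a L U G us lams := by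
  refine _root_.exists_tendsto_multipliers (w := fun k => S.u k + S.d k)
    (v := fun k => S.r k - G (S.u k) - S.H k (S.d k)) ?_ S.feasible_trial ?_ ?_ S.normal hli
  · simpa using hu.add hd
  · have hr : Tendsto S.r l (𝓝 0) := (S.tendsto_residual hd).trans_tendsto hd
    have hH : Tendsto (fun k => S.H k (S.d k)) l (𝓝 0) := by
      obtain ⟨B, hB⟩ := S.H_bounded
      have h0 : Tendsto (fun k => B * ‖S.d k‖) l (𝓝 0) := by simpa using hd.norm.const_mul B
      exact squeeze_zero_norm (fun k => (S.H k).le_of_opNorm_le (hB k) _) h0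
    simpa using (hr.sub ((hGc.tendsto us).comp hu)).sub hH
  · intro k
    rw [← S.kkt k]
    abel

variable [FiniteDimensional ℝ V]

theorem exists_tendsto_obj (hΦ : Continuous Φ) : ∃ c, Tendsto (fun k => Φ (S.u k)) atTop (𝓝 c) := by
  have hc : IsCompact (closure (Set.range S.u)) := S.bounded.isCompact_closure
  have hb : BddBelow (Set.range fun k => Φ (S.u k)) :=
    (hc.bddBelow_image hΦ.continuousOn).mono (by
      rintro _ ⟨k, rfl⟩
      exact ⟨S.u k, subset_closure ⟨k, rfl⟩, rfl⟩)
  exact ⟨_, tendsto_atTop_ciInf S.antitone_obj hb⟩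

/-- The objective values converge, so `t k * ‖d k‖ ^ 2 → 0`, which settles the unit steps. Otherwise
the step `t k / σ` was rejected. By the mean value theorem the slope along `d k` then rises from at
most `-⟪d, H d⟫` to above `-ρ * ⟪d, H d⟫` within that step, so uniform continuity of `G` bounds `t k
* ‖d k‖` from below as long as `‖d k‖ ≥ ε`. -/
theorem tendsto_dir (hG : ∀ u, HasGradientAt Φ (G u) u) (hGc : Continuous G) :
    Tendsto S.d atTop (𝓝 0) := by
  have hΦ : Continuous Φ :=
    continuous_iff_continuousAt.2 fun u => (hG u).hasFDerivAt.continuousAt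
  obtain ⟨c, hc⟩ := S.exists_tendsto_obj hΦ
  have hdec : Tendsto (fun k => S.t k * ‖S.d k‖ ^ 2) atTop (𝓝 0) := by
    have h1 : Tendsto (fun k => (Φ (S.u k) - Φ (S.u (k + 1))) / (S.ρ * S.η)) atTop (𝓝 0) := by
      have := (hc.sub (hc.comp (tendsto_add_atTop_nat 1))).div_const (S.ρ * S.η)
      simpa using this
    refine squeeze_zero (fun k => mul_nonneg (S.t_pos k).le (sq_nonneg _)) (fun k => ?_) h1
    rw [le_div_iff₀ (mul_pos S.ρ_pos S.η_pos)]
    linarith [S.decrease k]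
  obtain ⟨M, hM⟩ := S.bounded.isCompact_closure.exists_bound_of_continuousOn
    (f := G) hGc.continuousOn
  have hd : ∀ k, ‖S.d k‖ ≤ M / S.η := fun k => by
    rw [le_div_iff₀ S.η_pos]
    have := hM _ (subset_closure ⟨k, rfl⟩ : S.u k ∈ closure (Set.range S.u))
    linarith [S.norm_dir_le k]
  obtain ⟨R, hR⟩ := S.bounded.subset_closedBall 0
  have hu : ∀ k, ‖S.u k‖ ≤ R := fun k => by simpa using hR ⟨k, rfl⟩
  -- This ball contains all iterates and all points `u k + ξ • d k` with `0 ≤ ξ ≤ 1`.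
  have hunif := (isCompact_closedBall (0 : V) (R + M / S.η)).uniformContinuousOn_of_continuous
    hGc.continuousOn
  rw [Metric.uniformContinuousOn_iff] at hunif
  have hρ1 : 0 < 1 - S.ρ := by linarith [S.ρ_lt]
  rw [NormedAddGroup.tendsto_nhds_zero]
  intro ε hε
  obtain ⟨δ, hδ, hunif⟩ := hunif ((1 - S.ρ) * S.η * ε) (mul_pos (mul_pos hρ1 S.η_pos) hε)
  -- The two thresholds contradict `‖d k‖ ≥ ε` for backtracked and for unit steps, respectively.
  have hm : 0 < min (S.σ * δ * ε) (ε ^ 2) :=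
    lt_min (mul_pos (mul_pos S.σ_pos hδ) hε) (by positivity)
  filter_upwards [hdec.eventually_lt_const hm] with k hk
  by_contra! hle
  refine absurd hk (not_lt.2 ?_)
  have hdpos : 0 < ‖S.d k‖ := hε.trans_le hle
  by_cases ht : S.t k = 1
  · rw [ht, one_mul]
    refine (min_le_right _ _).trans ?_
    gcongr
  refine (min_le_left _ _).trans ?_
  obtain ⟨hs1, hs2⟩ := S.backtrack k ht
  set s := S.t k / S.σ with hs
  have hspos : 0 < s := div_pos (S.t_pos k) S.σ_pos
  obtain ⟨ξ, hξ, hmv⟩ := exists_hasDerivAt_eq_slope (fun s : ℝ => Φ (S.u k + s • S.d k)) _ hspos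
    (fun x _ => (hasDerivAt_comp_line hG _ _ x).continuousAt.continuousWithinAt)
    (fun x _ => hasDerivAt_comp_line hG (S.u k) (S.d k) x)
  have hq := S.coercive k (S.d k)
  have hdes := S.descent k
  have h1 : -S.ρ * inner ℝ (S.d k) (S.H k (S.d k)) <
      inner ℝ (G (S.u k + ξ • S.d k)) (S.d k) := by
    rw [hmv, sub_zero, zero_smul, add_zero, lt_div_iff₀ hspos]
    linarith
  have h2 : (1 - S.ρ) * (S.η * ‖S.d k‖ ^ 2) <
      inner ℝ (G (S.u k + ξ • S.d k) - G (S.u k)) (S.d k) := by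
    rw [inner_sub_left]
    nlinarith
  have h3 := h2.trans_le (real_inner_le_norm _ _)
  have h4 : (1 - S.ρ) * S.η * ε < ‖G (S.u k + ξ • S.d k) - G (S.u k)‖ := by
    have h5 : (1 - S.ρ) * S.η * ‖S.d k‖ < ‖G (S.u k + ξ • S.d k) - G (S.u k)‖ := by
      nlinarith
    refine lt_of_le_of_lt ?_ h5
    exact mul_le_mul_of_nonneg_left hle (mul_pos hρ1 S.η_pos).le
  have h6 : δ ≤ dist (S.u k + ξ • S.d k) (S.u k) := by
    by_contra! hlt
    have hξd : ‖ξ • S.d k‖ ≤ M / S.η := by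
      rw [norm_smul, Real.norm_of_nonneg hξ.1.le]
      nlinarith [hd k, hξ.1, hξ.2, norm_nonneg (S.d k)]
    have hm1 : S.u k + ξ • S.d k ∈ Metric.closedBall (0 : V) (R + M / S.η) := by
      rw [mem_closedBall_zero_iff]
      exact (norm_add_le _ _).trans (add_le_add (hu k) hξd)
    have hm2 : S.u k ∈ Metric.closedBall (0 : V) (R + M / S.η) := by
      rw [mem_closedBall_zero_iff]
      linarith [hu k, norm_nonneg (S.d k), hd k]
    have := hunif _ hm1 _ hm2 hlt
    rw [dist_eq_norm] at this
    linarith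
  rw [dist_eq_norm, add_sub_cancel_left, norm_smul, Real.norm_of_nonneg hξ.1.le] at h6
  have h7 : δ ≤ s * ‖S.d k‖ := h6.trans (mul_le_mul_of_nonneg_right hξ.2.le hdpos.le)
  have h8 : S.t k = S.σ * s := by rw [hs]; field_simp [S.σ_pos.ne']
  rw [h8]
  calc S.σ * δ * ε ≤ S.σ * (s * ‖S.d k‖) * ‖S.d k‖ := by
        have := S.σ_pos
        gcongr
    _ = _ := by ring

/-- The iterates converge to an accumulation point with local quadratic growth. -/
theorem tendsto_of_growth (hG : ∀ u, HasGradientAt Φ (G u) u) (hGc : Continuous G) {us : V}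
    (hacc : MapClusterPt us atTop S.u) {κ δ : ℝ} (hκ : 0 < κ) (hδ : 0 < δ)
    (hgrow : ∀ u ∈ Metric.ball us δ, BoxFeasible a L U u → κ * ‖u - us‖ ^ 2 ≤ Φ u - Φ us) :
    Tendsto S.u atTop (𝓝 us) := by
  have hΦ : Continuous Φ :=
    continuous_iff_continuousAt.2 fun u => (hG u).hasFDerivAt.continuousAt
  have hd := S.tendsto_dir hG hGc
  obtain ⟨c, hc⟩ := S.exists_tendsto_obj hΦ
  have hcs : c = Φ us := by
    obtain ⟨φ, hφ, hφu⟩ := hacc.tendsto_subseq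
    exact tendsto_nhds_unique (hc.comp hφ.tendsto_atTop) ((hΦ.tendsto us).comp hφu)
  rw [hcs] at hc
  rw [Metric.tendsto_nhds]
  intro ε hε
  obtain ⟨e, he0, heε, heδ⟩ : ∃ e > 0, e ≤ ε ∧ 2 * e ≤ δ :=
    ⟨min ε (δ / 2), by positivity, min_le_left _ _, by linarith [min_le_right ε (δ / 2)]⟩
  have h1 : ∀ᶠ k in atTop, ‖S.d k‖ < e := by
    rw [NormedAddGroup.tendsto_nhds_zero] at hd
    exact hd e he0
  have h2 : ∀ᶠ k in atTop, Φ (S.u k) < Φ us + κ * e ^ 2 :=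
    hc.eventually_lt_const (by have := mul_pos hκ (pow_pos he0 2); linarith)
  obtain ⟨N, hN⟩ := eventually_atTop.1 (h1.and h2)
  -- Growth and the convergence of the objective values exclude late iterates from the shell between
  -- radii `e` and `δ`. Steps are shorter than `e` and `2 * e ≤ δ`, so an iterate inside radius `e`
  -- cannot jump over the shell.
  have hstay : ∀ k ≥ N, dist (S.u k) us < δ → dist (S.u k) us < e := by
    intro k hk hkδ
    have h3 := hgrow _ hkδ (S.feasible_u k)
    have h4 := (hN k hk).2
    rw [dist_eq_norm]
    have : ‖S.u k - us‖ ^ 2 < e ^ 2 := by nlinarith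
    exact lt_of_pow_lt_pow_left₀ 2 he0.le this
  obtain ⟨n, hn1, hn2⟩ : ∃ n ≥ N, dist (S.u n) us < e := by
    have := (mapClusterPt_iff_frequently.1 hacc) _ (Metric.ball_mem_nhds us he0)
    obtain ⟨n, hn, hn'⟩ := (frequently_atTop.1 this) N
    exact ⟨n, hn, hn'⟩
  have hall : ∀ k ≥ n, dist (S.u k) us < e := by
    intro k hk
    induction k, hk using Nat.le_induction with
    | base => exact hn2
    | succ k hk ih =>
      refine hstay _ (by omega) ?_
      have h5 : dist (S.u (k + 1)) (S.u k) < e := by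
        rw [S.succ, dist_eq_norm, add_sub_cancel_left, norm_smul,
          Real.norm_of_nonneg (S.t_pos k).le]
        have := (hN k (by omega)).1
        nlinarith [S.t_le_one k, S.t_pos k, norm_nonneg (S.d k)]
      linarith [dist_triangle (S.u (k + 1)) (S.u k) us]
  exact eventually_atTop.2 ⟨n, fun k hk => (hall k hk).trans_le heε⟩

/-- Global convergence to an accumulation point satisfying LICQ and the second-order condition. -/
theorem tendsto_of_secondOrder (hG : ∀ u, HasGradientAt Φ (G u) u) (hGc : Continuous G) {us : V}
    {Q : V →L[ℝ] V} (hQ : HasStrictFDerivAt G Q us) (hacc : MapClusterPt us atTop S.u)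
    (hli : LinearIndependent ℝ (fun i : {i // BoxActive a L U us i} => a i))
    (hS : ∀ lam, BoxKKT a L U G us lam → ∀ w, w ≠ 0 →
      (∀ i, lam i ≠ 0 → inner ℝ (a i) w = 0) → 0 < inner ℝ w (Q w)) :
    Tendsto S.u atTop (𝓝 us) := by
  obtain ⟨φ, hφ, hφu⟩ := hacc.tendsto_subseq
  have hmono := hφ.tendsto_atTop
  obtain ⟨lams, -, hK⟩ := S.exists_tendsto_multipliers hGc (l := map φ atTop)
    (tendsto_map'_iff.2 hφu) ((S.tendsto_dir hG hGc).mono_left hmono) hli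
  obtain ⟨κ, hκ, δ, hδ, hgrow⟩ := hK.quadratic_growth hG hQ (hS lams hK)
  exact S.tendsto_of_growth hG hGc hacc hκ hδ hgrow

end BoxSQO

/-! ### Superlinear convergence of the abstract method -/

namespace BoxSQO

variable {V : Type*} [NormedAddCommGroup V] [InnerProductSpace ℝ V]
  {ι : Type*} [Fintype ι] {a : ι → V} {L U : ι → EReal} {Φ : V → ℝ} {G : V → V}
  (S : BoxSQO a L U Φ G)

/-- Constraints with a nonzero limit multiplier are eventually active at the trial points. -/
theorem eventually_inner_eq_zero {us : V} {lams : ι → ℝ}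
    (hlam : Tendsto S.lam atTop (𝓝 lams)) (hK : BoxKKT a L U G us lams) :
    ∀ᶠ k in atTop, ∀ i, lams i ≠ 0 → inner ℝ (a i) (S.u k + S.d k - us) = 0 := by
  rw [eventually_all]
  intro i
  have h1 := tendsto_pi_nhds.1 hlam i
  rcases lt_trichotomy (lams i) 0 with h | h | h
  · filter_upwards [h1.eventually_lt_const h] with k hk _
    have := ((S.normal k i).2 hk).trans ((hK.2.2 i).2 h).symm
    rw [inner_sub_right, sub_eq_zero]
    exact_mod_cast this
  · exact Eventually.of_forall fun k hk => absurd h hk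
  · filter_upwards [h1.eventually_const_lt h] with k hk _
    have := ((S.normal k i).1 hk).trans ((hK.2.2 i).1 h).symm
    rw [inner_sub_right, sub_eq_zero]
    exact_mod_cast this

section Superlinear

variable {us : V} {lams : ι → ℝ} {Q : V →L[ℝ] V} {p : ℕ → V} {c : ℕ → ι → ℝ}

/-- As `d k` is the difference of the errors at the trial point and at `u k`, and the former is
eventually at most `‖d k‖ / 2`, one gets `‖d k‖ ≤ 2 * ‖u k - us‖`. With unit steps the trial point
is the next iterate. -/
theorem succ_isLittleO (htrial : (fun k => S.u k + S.d k - us) =o[atTop] S.d)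
    (hstep : ∀ᶠ k in atTop, S.t k = 1) :
    (fun k => S.u (k + 1) - us) =o[atTop] (fun k => S.u k - us) := by
  have h1 : S.d =O[atTop] fun k => S.u k - us := by
    refine Asymptotics.IsBigO.of_bound 2 ?_
    filter_upwards [htrial.def (by norm_num : (0 : ℝ) < 1 / 2)] with k hk
    have h2 := norm_sub_le (S.u k + S.d k - us) (S.u k - us)
    rw [show S.u k + S.d k - us - (S.u k - us) = S.d k by abel] at h2
    linarith
  refine (htrial.trans_isBigO h1).congr' ?_ EventuallyEq.rfl
  filter_upwards [hstep] with k hk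
  rw [S.succ, hk, one_smul]

variable [FiniteDimensional ℝ V]

/-- The distance of the trial points to the solution is of higher order than the directions. -/
theorem trial_isLittleO (hG : ∀ u, HasGradientAt Φ (G u) u) (hQ : HasStrictFDerivAt G Q us)
    (hu : Tendsto S.u atTop (𝓝 us)) (hd : Tendsto S.d atTop (𝓝 0))
    (hlam : Tendsto S.lam atTop (𝓝 lams)) (hK : BoxKKT a L U G us lams)
    (hpos : ∀ w, w ≠ 0 → (∀ i, lams i ≠ 0 → inner ℝ (a i) w = 0) → 0 < inner ℝ w (Q w))
    (hdec : ∀ k, S.H k (S.d k) - Q (S.d k) = p k + ∑ i, c k i • a i)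
    (hp : p =o[atTop] S.d) (hcs : ∀ᶠ k in atTop, ∀ i, c k i ≠ 0 → lams i ≠ 0) :
    (fun k => S.u k + S.d k - us) =o[atTop] S.d := by
  classical
  obtain ⟨κ, hκ, c₀, -, hfin⟩ := exists_finsler (a := a) Q
    (Finset.univ.filter fun i => lams i ≠ 0) (fun w hw h => hpos w hw fun i hi => h i (by simp [hi]))
  rw [Asymptotics.isLittleO_iff]
  intro ε hε
  -- The estimate to come is `κ * ‖w‖ ≤ 3 * ε₁ * ‖d‖ + ε₁ * ‖w‖`. The first condition absorbs the
  -- last term into `κ / 2 * ‖w‖`, the second turns the rest into `ε * ‖d‖`.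
  obtain ⟨ε₁, hε₁, hε₁κ, hε₁ε⟩ : ∃ ε₁ > 0, 2 * ε₁ ≤ κ ∧ 6 * ε₁ ≤ ε * κ :=
    ⟨min (κ / 2) (ε * κ / 6), by positivity, by linarith [min_le_left (κ / 2) (ε * κ / 6)],
      by linarith [min_le_right (κ / 2) (ε * κ / 6)]⟩
  obtain ⟨δ, hδ, htay⟩ := eventually_taylor_two hG hQ hε₁
  have hud : Tendsto (fun k => S.u k + S.d k) atTop (𝓝 us) := by simpa using hu.add hd
  filter_upwards [hu.eventually (Metric.ball_mem_nhds us hδ),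
    hud.eventually (Metric.ball_mem_nhds us hδ), hp.def hε₁, (S.tendsto_residual hd).def hε₁,
    hcs, S.eventually_inner_eq_zero hlam hK] with k hku hkud hkp hkr hkc hkz
  have e1 := (htay us (Metric.mem_ball_self hδ) _ hkud).1
  have e2 := (htay _ hku _ hkud).1
  rw [add_sub_cancel_left] at e2
  set w := S.u k + S.d k - us with hw
  have hzero : ∑ i ∈ Finset.univ.filter (fun i => lams i ≠ 0), inner ℝ (a i) w ^ 2 = 0 :=
    Finset.sum_eq_zero fun i hi => by rw [hkz i (Finset.mem_filter.1 hi).2]; simp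
  have hq := hfin w
  rw [hzero, mul_zero, add_zero] at hq
  have hcz : ∀ i, c k i * inner ℝ (a i) w = 0 := fun i => by
    by_cases h : c k i = 0
    · simp [h]
    · rw [hkz i (hkc i h), mul_zero]
  -- Difference of the inexact KKT system at the trial point and the exact one at `us`; the
  -- parenthesis collects the higher-order errors.
  have hQw : Q w = (S.r k - p k + (G (S.u k + S.d k) - G (S.u k) - Q (S.d k))
      - (G (S.u k + S.d k) - G us - Q w))
      - ∑ i, (S.lam k i - lams i) • a i - ∑ i, c k i • a i := by
    have h1 := S.kkt k
    have h2 := hdec k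
    have h3 := hK.2.1
    rw [sub_eq_iff_eq_add] at h2
    rw [h2] at h1
    simp only [sub_smul, Finset.sum_sub_distrib]
    rw [← h1, eq_neg_of_add_eq_zero_right h3]
    abel
  have hmono : 0 ≤ ∑ i, (S.lam k i - lams i) * inner ℝ (a i) w :=
    Finset.sum_nonneg fun i _ => by
      have h1 := (S.normal k).mul_nonneg hK.1 i
      have h2 := hK.2.2.mul_nonneg (S.feasible_trial k) i
      rw [← neg_sub, inner_neg_right] at h2
      rw [sub_mul]
      linarith
  set R := S.r k - p k + (G (S.u k + S.d k) - G (S.u k) - Q (S.d k))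
      - (G (S.u k + S.d k) - G us - Q w) with hR
  have hRn : ‖R‖ ≤ 3 * ε₁ * ‖S.d k‖ + ε₁ * ‖w‖ := by
    have h1 := norm_sub_le (S.r k - p k + (G (S.u k + S.d k) - G (S.u k) - Q (S.d k)))
      (G (S.u k + S.d k) - G us - Q w)
    have h2 := norm_add_le (S.r k - p k) (G (S.u k + S.d k) - G (S.u k) - Q (S.d k))
    have h3 := norm_sub_le (S.r k) (p k)
    linarith
  have hin : inner ℝ w (Q w) = inner ℝ w R - ∑ i, (S.lam k i - lams i) * inner ℝ (a i) w := by
    rw [hQw, inner_sub_right, inner_sub_right, inner_sum, inner_sum]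
    simp only [real_inner_comm _ w, real_inner_smul_left]
    rw [Finset.sum_eq_zero fun i _ => hcz i, sub_zero]
  have hfinal : κ * ‖w‖ ^ 2 ≤ ‖w‖ * (3 * ε₁ * ‖S.d k‖ + ε₁ * ‖w‖) :=
    calc κ * ‖w‖ ^ 2 ≤ inner ℝ w R := by linarith
      _ ≤ ‖w‖ * ‖R‖ := real_inner_le_norm _ _
      _ ≤ _ := by gcongr
  rcases (norm_nonneg w).eq_or_lt with h0 | h0
  · rw [← h0]; positivity
  · have h1 : κ * ‖w‖ ≤ 3 * ε₁ * ‖S.d k‖ + ε₁ * ‖w‖ := by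
      refine le_of_mul_le_mul_left ?_ h0
      linarith
    have h2 : κ * ‖w‖ ≤ κ * (ε * ‖S.d k‖) := by
      nlinarith [mul_le_mul_of_nonneg_right hε₁κ h0.le,
        mul_le_mul_of_nonneg_right hε₁ε (norm_nonneg (S.d k))]
    exact le_of_mul_le_mul_left h2 hκ

/-- The unit step size is eventually accepted. -/
theorem eventually_unit_step (hG : ∀ u, HasGradientAt Φ (G u) u) (hQ : HasStrictFDerivAt G Q us)
    (hu : Tendsto S.u atTop (𝓝 us)) (hd : Tendsto S.d atTop (𝓝 0))
    (hlam : Tendsto S.lam atTop (𝓝 lams))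
    (hdec : ∀ k, S.H k (S.d k) - Q (S.d k) = p k + ∑ i, c k i • a i)
    (hp : p =o[atTop] S.d) (hc : Tendsto c atTop (𝓝 0))
    (hcs : ∀ᶠ k in atTop, ∀ i, c k i ≠ 0 → lams i ≠ 0) :
    ∀ᶠ k in atTop, S.t k = 1 := by
  have hρ : 0 < (1 / 2 - S.ρ) * S.η := mul_pos (by linarith [S.ρ_lt]) S.η_pos
  -- The errors from the expansion, from `r` and from half of `p` cost at most `5 / 2 * ε * ‖d‖ ^
  -- 2`; the available margin is `(1 / 2 - ρ) * ⟪d, H d⟫ ≥ 3 * ε * ‖d‖ ^ 2`.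
  obtain ⟨ε, hε, hεeq⟩ : ∃ ε > 0, 3 * ε = (1 / 2 - S.ρ) * S.η :=
    ⟨(1 / 2 - S.ρ) * S.η / 3, by positivity, by ring⟩
  obtain ⟨δ, hδ, htay⟩ := eventually_taylor_two hG hQ hε
  have hud : Tendsto (fun k => S.u k + S.d k) atTop (𝓝 us) := by simpa using hu.add hd
  have hcl : ∀ᶠ k in atTop, ∀ i, lams i ≠ 0 → |c k i| ≤ |S.lam k i| := by
    rw [eventually_all]
    intro i
    by_cases hi : lams i = 0
    · exact Eventually.of_forall fun k h => absurd hi h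
    · have h1 : Tendsto (fun k => |S.lam k i| - |c k i|) atTop (𝓝 (|lams i| - |0|)) :=
        (tendsto_pi_nhds.1 hlam i).abs.sub (tendsto_pi_nhds.1 hc i).abs
      rw [abs_zero, sub_zero] at h1
      filter_upwards [h1.eventually_const_lt (abs_pos.2 hi)] with k hk _
      linarith
  filter_upwards [hu.eventually (Metric.ball_mem_nhds us hδ),
    hud.eventually (Metric.ball_mem_nhds us hδ), hp.def hε, (S.tendsto_residual hd).def hε,
    hcs, hcl] with k hku hkud hkp hkr hkc hkcl
  refine S.full_step k ?_
  have e1 := (abs_le.1 (htay _ hku _ hkud).2).2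
  rw [add_sub_cancel_left] at e1
  have hlamd : ∀ i, 0 ≤ S.lam k i * inner ℝ (a i) (S.d k) := fun i => by
    simpa using (S.normal k).mul_nonneg (S.feasible_u k) i
  -- The sign of the `c`-terms is unknown, but they are dominated by the nonnegative multiplier
  -- terms, which occur in the decrease with twice their weight.
  have hcd : -∑ i, c k i * inner ℝ (a i) (S.d k) ≤ ∑ i, S.lam k i * inner ℝ (a i) (S.d k) := by
    rw [← Finset.sum_neg_distrib]
    refine Finset.sum_le_sum fun i _ => ?_
    by_cases h : c k i = 0
    · simpa [h] using hlamd i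
    · calc -(c k i * inner ℝ (a i) (S.d k)) ≤ |c k i * inner ℝ (a i) (S.d k)| := neg_le_abs _
        _ ≤ |S.lam k i * inner ℝ (a i) (S.d k)| := by
          rw [abs_mul, abs_mul]
          exact mul_le_mul_of_nonneg_right (hkcl i (hkc i h)) (abs_nonneg _)
        _ = _ := abs_of_nonneg (hlamd i)
  have hkkt := congrArg (fun z => inner ℝ (S.d k) z) (S.kkt k)
  have hdec' := congrArg (fun z => inner ℝ (S.d k) z) (hdec k)
  simp only [inner_add_right, inner_sub_right, inner_sum, inner_smul_right] at hkkt hdec'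
  simp only [real_inner_comm (S.d k)] at hkkt hdec' e1 hcd hlamd ⊢
  have hq := S.coercive k (S.d k)
  rw [real_inner_comm] at hq
  have hr := (real_inner_comm (S.r k) (S.d k)).trans_le ((real_inner_le_norm (S.r k) (S.d k)).trans
    (mul_le_mul_of_nonneg_right hkr (norm_nonneg _)))
  have hpd := (abs_le.1 ((abs_real_inner_le_norm (p k) (S.d k)).trans
    (mul_le_mul_of_nonneg_right hkp (norm_nonneg _)))).1
  rw [← real_inner_comm] at hpd
  have hsum := Finset.sum_nonneg fun i (_ : i ∈ Finset.univ) => hlamd i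
  rw [real_inner_comm (S.d k)] at hq
  have hq2 := mul_le_mul_of_nonneg_left hq (by linarith [S.ρ_lt] : 0 ≤ 1 / 2 - S.ρ)
  have hnn : 0 ≤ ε * ‖S.d k‖ ^ 2 := by positivity
  nlinarith

end Superlinear

/-- Decomposition of the Hessian error when only its component outside the span of the working
constraints is of higher order, under strict complementarity. -/
theorem exists_coefficients_of_span {us : V} {Q : V →L[ℝ] V} {p : ℕ → V}
    (hu : Tendsto S.u atTop (𝓝 us)) (hd : Tendsto S.d atTop (𝓝 0))
    (hli : LinearIndependent ℝ (fun i : {i // BoxActive a L U us i} => a i))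
    {W : ℕ → Set ι} (hW : ∀ k, ∀ i ∈ W k, BoxActive a L U (S.u k + S.d k) i)
    (hspan : ∀ k, S.H k (S.d k) - Q (S.d k) - p k ∈ Submodule.span ℝ (a '' W k))
    (hp : p =o[atTop] S.d) :
    ∃ c : ℕ → ι → ℝ, (∀ k, S.H k (S.d k) - Q (S.d k) = p k + ∑ i, c k i • a i) ∧
      Tendsto c atTop (𝓝 0) ∧ ∀ k, ∀ i, c k i ≠ 0 → i ∈ W k := by
  classical
  have hex : ∀ k, ∃ c : ι → ℝ, S.H k (S.d k) - Q (S.d k) - p k = ∑ i, c i • a i ∧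
      ∀ i, c i ≠ 0 → i ∈ W k := by
    intro k
    obtain ⟨f, hf, hfs⟩ := (Finsupp.mem_span_image_iff_linearCombination ℝ).1 (hspan k)
    refine ⟨f, ?_, fun i hi => ?_⟩
    · rw [← hfs, Finsupp.linearCombination_apply, Finsupp.sum_fintype _ _ (by simp)]
    · exact (Finsupp.mem_supported _ _).1 hf (Finsupp.mem_support_iff.2 hi)
  choose c hc hcW using hex
  refine ⟨c, fun k => by rw [← hc k]; abel, ?_, hcW⟩
  have hHQ : Tendsto (fun k => S.H k (S.d k) - Q (S.d k)) atTop (𝓝 0) := by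
    obtain ⟨B, hB⟩ := S.H_bounded
    have h0 : Tendsto (fun k => B * ‖S.d k‖) atTop (𝓝 0) := by simpa using hd.norm.const_mul B
    simpa using (squeeze_zero_norm (fun k => (S.H k).le_of_opNorm_le (hB k) _) h0).sub
      ((Q.continuous.tendsto 0).comp hd)
  have hsum : Tendsto (fun k => ∑ i, c k i • a i) atTop (𝓝 0) := by
    simp only [← hc]
    simpa using hHQ.sub (hp.trans_tendsto hd)
  have hud : Tendsto (fun k => S.u k + S.d k) atTop (𝓝 us) := by simpa using hu.add hd
  -- Working rows are eventually active at `us`, so LICQ applies and the vanishing sum forces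
  -- vanishing coefficients.
  obtain ⟨cs, hcs, -, hz⟩ := exists_tendsto_coefficients hli hsum (by
    filter_upwards [eventually_active_imp (a := a) (L := L) (U := U) hud] with k hk i hi
    exact hk i (hW k i (hcW k i hi)))
  rwa [hz rfl] at hcs

/-- Superlinear convergence under a Dennis–Moré-type condition with error `p`. -/
theorem superlinear [FiniteDimensional ℝ V] (hG : ∀ u, HasGradientAt Φ (G u) u)
    (hGc : Continuous G) {us : V} {Q : V →L[ℝ] V} {p : ℕ → V}
    (hQ : HasStrictFDerivAt G Q us) (hu : Tendsto S.u atTop (𝓝 us))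
    (hli : LinearIndependent ℝ (fun i : {i // BoxActive a L U us i} => a i))
    (hpos : ∀ lam, BoxKKT a L U G us lam → ∀ w, w ≠ 0 →
      (∀ i, lam i ≠ 0 → inner ℝ (a i) w = 0) → 0 < inner ℝ w (Q w))
    {W : ℕ → Set ι} (hW : ∀ k, ∀ i ∈ W k, BoxActive a L U (S.u k + S.d k) i)
    (hspan : ∀ k, S.H k (S.d k) - Q (S.d k) - p k ∈ Submodule.span ℝ (a '' W k))
    (hp : p =o[atTop] S.d)
    (hstrict : (∀ k, W k = ∅) ∨
      ∀ lam, BoxKKT a L U G us lam → ∀ i, BoxActive a L U us i → lam i ≠ 0) :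
    (fun k => S.u (k + 1) - us) =o[atTop] (fun k => S.u k - us) := by
  have hd := S.tendsto_dir hG hGc
  obtain ⟨lams, hlam, hK⟩ := S.exists_tendsto_multipliers hGc hu hd hli
  obtain ⟨c, hdec, hc, hcW⟩ := S.exists_coefficients_of_span hu hd hli hW hspan hp
  have hud : Tendsto (fun k => S.u k + S.d k) atTop (𝓝 us) := by simpa using hu.add hd
  have hcs : ∀ᶠ k in atTop, ∀ i, c k i ≠ 0 → lams i ≠ 0 := by
    rcases hstrict with h | h
    · refine Eventually.of_forall fun k i hi => ?_
      have := hcW k i hi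
      rw [h k] at this
      exact absurd this (Set.notMem_empty i)
    · filter_upwards [eventually_active_imp (a := a) (L := L) (U := U) hud] with k hk i hi
      exact h lams hK i (hk i (hW k i (hcW k i hi)))
  exact S.succ_isLittleO
    (S.trial_isLittleO hG hQ hu hd hlam hK (hpos lams hK) hdec hp hcs)
    (S.eventually_unit_step hG hQ hu hd hlam hdec hp hc hcs)

end BoxSQO

/-! ### Hessian matrices as derivatives of gradients -/

section Hessian

variable {n : ℕ} {g : Vec n → ℝ} {x : Vec n}

/-- The operator on Euclidean space given by the second derivative of `g`. -/
theorem toEuclideanCLM_hess_apply (hg : ContDiffAt ℝ 2 g x) (z : Vec n) (i : Fin n) :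
    (toEuclideanCLM (𝕜 := ℝ) (hess g x) z) i =
      fderiv ℝ (fderiv ℝ g) x z (EuclideanSpace.single i 1) := by
  -- In `hess` the row index feeds the first argument of the second derivative, so symmetry is
  -- needed to have `z` there.
  have hsymm : IsSymmSndFDerivAt ℝ g x := hg.isSymmSndFDerivAt (by simp)
  have hz : z = ∑ j, z j • EuclideanSpace.single j (1 : ℝ) := by
    ext i
    simp [Pi.single_apply]
  rw [hsymm.eq, ofLp_toEuclideanCLM]
  conv_rhs => rw [hz]
  simp [mulVec, dotProduct, hess, mul_comm]

theorem gradient_apply (i : Fin n) :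
    gradient g x i = fderiv ℝ g x (EuclideanSpace.single i 1) := by
  have h : inner ℝ (gradient g x) (EuclideanSpace.single i (1 : ℝ)) =
      fderiv ℝ g x (EuclideanSpace.single i 1) := by
    rw [gradient, InnerProductSpace.toDual_symm_apply]
  rw [← h, EuclideanSpace.inner_single_right, one_mul, conj_trivial]

theorem hasStrictFDerivAt_gradient (hg : ContDiffAt ℝ 2 g x) :
    HasStrictFDerivAt (gradient g) (toEuclideanCLM (𝕜 := ℝ) (hess g x)) x := by
  have h1 : HasStrictFDerivAt (fderiv ℝ g) (fderiv ℝ (fderiv ℝ g) x) x :=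
    (hg.fderiv_right (m := 1) (by norm_num)).hasStrictFDerivAt (by simp)
  rw [hasStrictFDerivAt_euclidean]
  intro i
  have h2 := h1.clm_apply (hasStrictFDerivAt_const (EuclideanSpace.single i (1 : ℝ)) x)
  have h3 : (fun y => gradient g y i) =
      fun y => fderiv ℝ g y (EuclideanSpace.single i 1) := funext fun y => gradient_apply i
  rw [h3]
  refine h2.congr_fderiv ?_
  ext z
  simpa using (toEuclideanCLM_hess_apply hg z i).symm

theorem continuousAt_hess (hg : ContDiffAt ℝ 2 g x) : ContinuousAt (hess g) x := by
  have h1 : ContinuousAt (fderiv ℝ (fderiv ℝ g)) x :=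
    ((hg.fderiv_right (m := 1) (by norm_num)).fderiv_right (m := 0) (by norm_num)).continuousAt
  refine continuousAt_pi.2 fun i => continuousAt_pi.2 fun j => ?_
  exact (h1.clm_apply continuousAt_const).clm_apply continuousAt_const

theorem continuous_gradient (hg : ContDiff ℝ 1 g) : Continuous (gradient g) :=
  (InnerProductSpace.toDual ℝ (Vec n)).symm.continuous.comp (hg.continuous_fderiv (by simp))

end Hessian

/-! ### Stacked vectors -/

section Pair

variable {n₁ n₂ : ℕ}

/-- The `x`-component of a stacked vector. -/
noncomputable def fstCLM (n₁ n₂ : ℕ) : EuclideanSpace ℝ (Fin n₁ ⊕ Fin n₂) →L[ℝ] Vec n₁ :=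
  LinearMap.toContinuousLinearMap
    { toFun := fun u => WithLp.toLp 2 fun i => u (Sum.inl i)
      map_add' := fun _ _ => rfl
      map_smul' := fun _ _ => rfl }

/-- The `y`-component of a stacked vector. -/
noncomputable def sndCLM (n₁ n₂ : ℕ) : EuclideanSpace ℝ (Fin n₁ ⊕ Fin n₂) →L[ℝ] Vec n₂ :=
  LinearMap.toContinuousLinearMap
    { toFun := fun u => WithLp.toLp 2 fun i => u (Sum.inr i)
      map_add' := fun _ _ => rfl
      map_smul' := fun _ _ => rfl }

@[simp] theorem fstCLM_apply (u : EuclideanSpace ℝ (Fin n₁ ⊕ Fin n₂)) (i : Fin n₁) :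
    fstCLM n₁ n₂ u i = u (Sum.inl i) := rfl

@[simp] theorem sndCLM_apply (u : EuclideanSpace ℝ (Fin n₁ ⊕ Fin n₂)) (i : Fin n₂) :
    sndCLM n₁ n₂ u i = u (Sum.inr i) := rfl

@[simp] theorem fstCLM_pair (x : Vec n₁) (y : Vec n₂) : fstCLM n₁ n₂ (pair x y) = x := rfl

@[simp] theorem sndCLM_pair (x : Vec n₁) (y : Vec n₂) : sndCLM n₁ n₂ (pair x y) = y := rfl

@[simp] theorem pair_inl (x : Vec n₁) (y : Vec n₂) (i : Fin n₁) : pair x y (Sum.inl i) = x i := rfl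

@[simp] theorem pair_inr (x : Vec n₁) (y : Vec n₂) (i : Fin n₂) : pair x y (Sum.inr i) = y i := rfl

theorem pair_ext {u v : EuclideanSpace ℝ (Fin n₁ ⊕ Fin n₂)}
    (h1 : fstCLM n₁ n₂ u = fstCLM n₁ n₂ v) (h2 : sndCLM n₁ n₂ u = sndCLM n₁ n₂ v) : u = v := by
  ext i
  rcases i with i | i
  · exact congrArg (fun w : Vec n₁ => w i) h1
  · exact congrArg (fun w : Vec n₂ => w i) h2

theorem pair_fst_snd (u : EuclideanSpace ℝ (Fin n₁ ⊕ Fin n₂)) :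
    pair (fstCLM n₁ n₂ u) (sndCLM n₁ n₂ u) = u := pair_ext rfl rfl

theorem pair_add_smul (x x' : Vec n₁) (y y' : Vec n₂) (t : ℝ) :
    pair x y + t • pair x' y' = pair (x + t • x') (y + t • y') := pair_ext rfl rfl

theorem pair_add_pair_sub (x x' : Vec n₁) (y y' : Vec n₂) :
    pair x y + pair (x' - x) (y' - y) = pair x' y' := by
  refine pair_ext ?_ ?_ <;> simp

theorem inner_pair (x x' : Vec n₁) (y y' : Vec n₂) :
    inner ℝ (pair x y) (pair x' y') = inner ℝ x x' + inner ℝ y y' := by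
  simp [PiLp.inner_apply]

end Pair

/-! ### The two-block problem in stacked form -/

namespace Problem

variable {n₁ n₂ m l₁ l₂ : ℕ} (P : Problem n₁ n₂ m l₁ l₂)

/-- The matrix of all constraints. -/
def fullMatrix : Matrix (Fin m ⊕ (Fin l₁ ⊕ Fin l₂)) (Fin n₁ ⊕ Fin n₂) ℝ :=
  Matrix.fromRows (Matrix.fromCols P.E P.F) (Matrix.fromBlocks P.C 0 0 P.D)

/-- The constraint normals. -/
noncomputable def row (i : Fin m ⊕ (Fin l₁ ⊕ Fin l₂)) : EuclideanSpace ℝ (Fin n₁ ⊕ Fin n₂) :=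
  WithLp.toLp 2 (P.fullMatrix i)

/-- The lower bounds of all constraints. -/
noncomputable def lower : Fin m ⊕ (Fin l₁ ⊕ Fin l₂) → EReal := Sum.elim (fun _ => ⊥) (Sum.elim P.l P.s)

/-- The upper bounds of all constraints. -/
noncomputable def upper : Fin m ⊕ (Fin l₁ ⊕ Fin l₂) → EReal :=
  Sum.elim (fun i => (P.d i : EReal)) (Sum.elim P.v P.r)

/-- The objective as a function of the stacked vector. -/
noncomputable def stackedObj (u : EuclideanSpace ℝ (Fin n₁ ⊕ Fin n₂)) : ℝ :=
  P.obj (fstCLM n₁ n₂ u) (sndCLM n₁ n₂ u)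

/-- The gradient of the objective as a stacked vector. -/
noncomputable def stackedGrad (u : EuclideanSpace ℝ (Fin n₁ ⊕ Fin n₂)) :
    EuclideanSpace ℝ (Fin n₁ ⊕ Fin n₂) :=
  pair (gradient P.f (fstCLM n₁ n₂ u)) (gradient P.θ (sndCLM n₁ n₂ u))

theorem hasGradientAt_stackedObj (u : EuclideanSpace ℝ (Fin n₁ ⊕ Fin n₂)) :
    HasGradientAt P.stackedObj (P.stackedGrad u) u := by
  have hf := ((P.f_smooth.differentiable (by simp)) (fstCLM n₁ n₂ u)).hasGradientAt.hasFDerivAt.comp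
    u (fstCLM n₁ n₂).hasFDerivAt
  have hθ := ((P.θ_smooth.differentiable (by simp)) (sndCLM n₁ n₂ u)).hasGradientAt.hasFDerivAt.comp
    u (sndCLM n₁ n₂).hasFDerivAt
  rw [hasGradientAt_iff_hasFDerivAt]
  refine (hf.add hθ).congr_fderiv ?_
  ext z
  conv_rhs => rw [← pair_fst_snd z]
  simp [stackedGrad, inner_pair]

theorem continuous_stackedGrad : Continuous P.stackedGrad := by
  have h1 := (continuous_gradient P.f_smooth).comp (fstCLM n₁ n₂).continuous
  have h2 := (continuous_gradient P.θ_smooth).comp (sndCLM n₁ n₂).continuous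
  refine (PiLp.continuous_toLp 2 _).comp (continuous_pi fun i => ?_)
  rcases i with i | i
  · exact (EuclideanSpace.proj (𝕜 := ℝ) i).continuous.comp h1
  · exact (EuclideanSpace.proj (𝕜 := ℝ) i).continuous.comp h2

theorem fromBlocks_mulVec_pair (A : Matrix (Fin n₁) (Fin n₁) ℝ) (B : Matrix (Fin n₂) (Fin n₂) ℝ)
    (x : Vec n₁) (y : Vec n₂) :
    toEuclideanCLM (𝕜 := ℝ) (Matrix.fromBlocks A 0 0 B) (pair x y) =
      pair (toEuclideanCLM (𝕜 := ℝ) A x) (toEuclideanCLM (𝕜 := ℝ) B y) := by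
  ext i
  rcases i with i | i <;>
  simp [ofLp_toEuclideanCLM, pair, Matrix.fromBlocks_mulVec]

theorem contDiffAt_of_feasible (hC2 : P.C2NearFeasible) {xs : Vec n₁} {ys : Vec n₂}
    (hfeas : (xs, ys) ∈ P.feasible) : ContDiffAt ℝ 2 P.f xs ∧ ContDiffAt ℝ 2 P.θ ys := by
  obtain ⟨U, hU, hsub, hf, hθ⟩ := hC2
  exact ⟨hf.contDiffAt ((isOpenMap_fst _ hU).mem_nhds ⟨_, hsub hfeas, rfl⟩),
    hθ.contDiffAt ((isOpenMap_snd _ hU).mem_nhds ⟨_, hsub hfeas, rfl⟩)⟩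

theorem hasStrictFDerivAt_stackedGrad {xs : Vec n₁} {ys : Vec n₂} (hf : ContDiffAt ℝ 2 P.f xs)
    (hθ : ContDiffAt ℝ 2 P.θ ys) :
    HasStrictFDerivAt P.stackedGrad (toEuclideanCLM (𝕜 := ℝ) (P.hessObj xs ys)) (pair xs ys) := by
  have h1 := HasStrictFDerivAt.comp (f := fstCLM n₁ n₂) (pair xs ys)
    (hasStrictFDerivAt_gradient (x := fstCLM n₁ n₂ (pair xs ys)) hf)
    (fstCLM n₁ n₂).hasStrictFDerivAt
  have h2 := HasStrictFDerivAt.comp (f := sndCLM n₁ n₂) (pair xs ys)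
    (hasStrictFDerivAt_gradient (x := sndCLM n₁ n₂ (pair xs ys)) hθ)
    (sndCLM n₁ n₂).hasStrictFDerivAt
  rw [hasStrictFDerivAt_euclidean] at h1 h2 ⊢
  intro i
  rcases i with i | i
  · refine (h1 i).congr_fderiv ?_
    ext z
    conv_rhs => rw [← pair_fst_snd z]
    simp [hessObj, fromBlocks_mulVec_pair]
  · refine (h2 i).congr_fderiv ?_
    ext z
    conv_rhs => rw [← pair_fst_snd z]
    simp [hessObj, fromBlocks_mulVec_pair]

theorem tendsto_hessObj {xs : Vec n₁} {ys : Vec n₂} (hf : ContDiffAt ℝ 2 P.f xs)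
    (hθ : ContDiffAt ℝ 2 P.θ ys) {α : Type*} {l : Filter α} {x : α → Vec n₁} {y : α → Vec n₂}
    (h : Tendsto (fun k => pair (x k) (y k)) l (𝓝 (pair xs ys))) :
    Tendsto (fun k => toEuclideanCLM (𝕜 := ℝ) (P.hessObj (x k) (y k))) l
      (𝓝 (toEuclideanCLM (𝕜 := ℝ) (P.hessObj xs ys))) := by
  have hx : Tendsto x l (𝓝 xs) := ((fstCLM n₁ n₂).continuous.tendsto (pair xs ys)).comp h
  have hy : Tendsto y l (𝓝 ys) := ((sndCLM n₁ n₂).continuous.tendsto (pair xs ys)).comp h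
  have h1 := (continuousAt_hess hf).tendsto.comp hx
  have h2 := (continuousAt_hess hθ).tendsto.comp hy
  have hcont : Continuous (fun A : Matrix (Fin n₁ ⊕ Fin n₂) (Fin n₁ ⊕ Fin n₂) ℝ =>
      toEuclideanCLM (𝕜 := ℝ) A) :=
    LinearMap.continuous_of_finiteDimensional
      (toEuclideanCLM (n := Fin n₁ ⊕ Fin n₂) (𝕜 := ℝ)).toAlgEquiv.toLinearMap
  refine (hcont.tendsto _).comp ?_
  refine tendsto_pi_nhds.2 fun i => tendsto_pi_nhds.2 fun j => ?_
  rcases i with i | i <;> rcases j with j | j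
  · exact tendsto_pi_nhds.1 (tendsto_pi_nhds.1 h1 i) j
  · exact tendsto_const_nhds
  · exact tendsto_const_nhds
  · exact tendsto_pi_nhds.1 (tendsto_pi_nhds.1 h2 i) j

theorem inner_row (u : EuclideanSpace ℝ (Fin n₁ ⊕ Fin n₂)) (i : Fin m ⊕ (Fin l₁ ⊕ Fin l₂)) :
    inner ℝ (P.row i) u = (P.fullMatrix *ᵥ u.ofLp) i := by
  simp [row, PiLp.inner_apply, mulVec, dotProduct, mul_comm]

theorem inner_row_pair (x : Vec n₁) (y : Vec n₂) (i : Fin m ⊕ (Fin l₁ ⊕ Fin l₂)) :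
    inner ℝ (P.row i) (pair x y) = Sum.elim (P.E *ᵥ x.ofLp + P.F *ᵥ y.ofLp)
      (Sum.elim (P.C *ᵥ x.ofLp) (P.D *ᵥ y.ofLp)) i := by
  rw [inner_row, fullMatrix, pair]
  rcases i with i | i | i <;>
  simp [Matrix.fromBlocks_mulVec, Matrix.fromRows_mulVec, Matrix.fromCols_mulVec]

theorem sum_smul_row (lam : Fin m ⊕ (Fin l₁ ⊕ Fin l₂) → ℝ) :
    ∑ i, lam i • P.row i =
      pair (WithLp.toLp 2 (P.Eᵀ *ᵥ (lam ∘ Sum.inl) + P.Cᵀ *ᵥ (lam ∘ Sum.inr ∘ Sum.inl)))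
        (WithLp.toLp 2 (P.Fᵀ *ᵥ (lam ∘ Sum.inl) + P.Dᵀ *ᵥ (lam ∘ Sum.inr ∘ Sum.inr))) := by
  ext j
  rcases j with j | j <;>
  simp [Fintype.sum_sum_type, row, fullMatrix, mulVec, dotProduct, mul_comm]

theorem h_apply (x : Vec n₁) (y : Vec n₂) (i : Fin m) :
    P.h x y i = (P.E *ᵥ x.ofLp) i + (P.F *ᵥ y.ofLp) i - P.d i := rfl

theorem boxFeasible_iff (x : Vec n₁) (y : Vec n₂) :
    BoxFeasible P.row P.lower P.upper (pair x y) ↔ (x, y) ∈ P.feasible := by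
  simp only [BoxFeasible, inner_row_pair, lower, upper, Sum.forall, Sum.elim_inl, Sum.elim_inr,
    feasible, Set.mem_ofPred_eq, InBox, h_apply, bot_le, true_and, EReal.coe_le_coe_iff,
    Pi.add_apply, sub_nonpos]

theorem boxActive_inl (x : Vec n₁) (y : Vec n₂) (i : Fin m) :
    BoxActive P.row P.lower P.upper (pair x y) (Sum.inl i) ↔ P.h x y i = 0 := by
  simp only [BoxActive, inner_row_pair, lower, upper, Sum.elim_inl, h_apply,
    EReal.coe_ne_bot, false_or, EReal.coe_eq_coe_iff, Pi.add_apply, sub_eq_zero]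

theorem boxActive_inr_inl (x : Vec n₁) (y : Vec n₂) (i : Fin l₁) :
    BoxActive P.row P.lower P.upper (pair x y) (Sum.inr (Sum.inl i)) ↔ i ∈ P.actI x := by
  simp [BoxActive, inner_row_pair, lower, upper, actI]

theorem boxActive_inr_inr (x : Vec n₁) (y : Vec n₂) (i : Fin l₂) :
    BoxActive P.row P.lower P.upper (pair x y) (Sum.inr (Sum.inr i)) ↔ i ∈ P.actJ y := by
  simp [BoxActive, inner_row_pair, lower, upper, actJ]

/-- Inclusion of the working rows into all rows. -/
def inclRows (S : Finset (Fin m)) (I : Finset (Fin l₁)) (J : Finset (Fin l₂)) :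
    S ⊕ (I ⊕ J) → Fin m ⊕ (Fin l₁ ⊕ Fin l₂) :=
  Sum.map Subtype.val (Sum.map Subtype.val Subtype.val)

theorem rowsMatrix_apply (S : Finset (Fin m)) (I : Finset (Fin l₁)) (J : Finset (Fin l₂))
    (i : S ⊕ (I ⊕ J)) : P.rowsMatrix S I J i = P.fullMatrix (inclRows S I J i) := by
  ext j
  rcases i with i | i | i <;> rcases j with j | j <;> rfl

theorem LICQ.linearIndependent {P : Problem n₁ n₂ m l₁ l₂} {x : Vec n₁} {y : Vec n₂}
    (h : P.LICQ x y) :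
    LinearIndependent ℝ (fun i : {i // BoxActive P.row P.lower P.upper (pair x y) i} =>
      P.row i) := by
  have hsel : ∀ i : {i // BoxActive P.row P.lower P.upper (pair x y) i},
      ∃ j, inclRows (P.actS x y) (P.actI x) (P.actJ y) j = i := by
    rintro ⟨i | i | i, hi⟩
    · exact ⟨Sum.inl ⟨i, by simpa [actS] using (P.boxActive_inl x y i).1 hi⟩, rfl⟩
    · exact ⟨Sum.inr (Sum.inl ⟨i, (P.boxActive_inr_inl x y i).1 hi⟩), rfl⟩
    · exact ⟨Sum.inr (Sum.inr ⟨i, (P.boxActive_inr_inr x y i).1 hi⟩), rfl⟩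
  choose s hs using hsel
  have hinj : Function.Injective s := fun i j hij => by
    rw [Subtype.ext_iff, ← hs i, ← hs j, hij]
  let e := (WithLp.linearEquiv 2 ℝ (Fin n₁ ⊕ Fin n₂ → ℝ)).symm
  have h1 := (h.comp s hinj).map' e.toLinearMap e.ker
  have h2 : (fun i : {i // BoxActive P.row P.lower P.upper (pair x y) i} => P.row i) =
      e.toLinearMap ∘
        (fun i => P.rowsMatrix (P.actS x y) (P.actI x) (P.actJ y) i) ∘ s := by
    funext i
    rw [Function.comp_apply, Function.comp_apply, rowsMatrix_apply, hs]
    rfl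
  rw [h2]
  exact h1

end Problem

/-! ### One-sided and signed multipliers -/

theorem BoxCompl.mul_nonneg {q : ℕ} {l v : Fin q → EReal} {z z' α γ : Fin q → ℝ}
    (h : BoxCompl l v z α γ) (h' : InBox l v z') (i : Fin q) :
    0 ≤ (γ i - α i) * (z i - z' i) := by
  obtain ⟨hα, hγ, hα', hγ'⟩ := h.2 i
  have h1 : 0 ≤ γ i * (z i - z' i) := by
    rcases hγ' with h0 | h0
    · simp [h0]
    · have := (h' i).2
      rw [← h0, EReal.coe_le_coe_iff] at this
      exact _root_.mul_nonneg hγ (by linarith)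
  have h2 : 0 ≤ α i * (z' i - z i) := by
    rcases hα' with h0 | h0
    · simp [h0]
    · have := (h' i).1
      rw [← h0, EReal.coe_le_coe_iff] at this
      exact _root_.mul_nonneg hα (by linarith)
  linarith

theorem BoxCompl.eq_upper {q : ℕ} {l v : Fin q → EReal} {z α γ : Fin q → ℝ}
    (h : BoxCompl l v z α γ) {i : Fin q} (hi : 0 < γ i - α i) : (z i : EReal) = v i := by
  obtain ⟨hα, hγ, hα', hγ'⟩ := h.2 i
  exact hγ'.resolve_left (by linarith)

theorem BoxCompl.eq_lower {q : ℕ} {l v : Fin q → EReal} {z α γ : Fin q → ℝ}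
    (h : BoxCompl l v z α γ) {i : Fin q} (hi : γ i - α i < 0) : (z i : EReal) = l i := by
  obtain ⟨hα, hγ, hα', hγ'⟩ := h.2 i
  exact hα'.resolve_left (by linarith)

theorem boxCompl_of_signed {q : ℕ} {l v : Fin q → EReal} {z lam : Fin q → ℝ} (h : InBox l v z)
    (h' : ∀ i, (0 < lam i → (z i : EReal) = v i) ∧ (lam i < 0 → (z i : EReal) = l i)) :
    BoxCompl l v z (fun i => max (-lam i) 0) (fun i => max (lam i) 0) := by
  refine ⟨h, fun i => ⟨le_max_right _ _, le_max_right _ _, ?_, ?_⟩⟩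
  · rcases lt_or_ge (lam i) 0 with h0 | h0
    · exact Or.inr ((h' i).2 h0)
    · exact Or.inl (max_eq_right (by linarith))
  · rcases lt_or_ge 0 (lam i) with h0 | h0
    · exact Or.inr ((h' i).1 h0)
    · exact Or.inl (max_eq_right h0)

/-- Stationarity of a quadratic subproblem gives a descent direction. -/
theorem dotProduct_le_neg_quadForm {n m q : ℕ} {g dx : Fin n → ℝ} {H : Matrix (Fin n) (Fin n) ℝ}
    {E : Matrix (Fin m) (Fin n) ℝ} {C : Matrix (Fin q) (Fin n) ℝ} {μ : Fin m → ℝ} {lam : Fin q → ℝ}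
    (h : g + H *ᵥ dx + Eᵀ *ᵥ μ + Cᵀ *ᵥ lam = 0) (hμ : ∀ i, 0 ≤ μ i * (E *ᵥ dx) i)
    (hlam : ∀ i, 0 ≤ lam i * (C *ᵥ dx) i) : g ⬝ᵥ dx ≤ -quadForm H dx := by
  have h1 := congrArg (fun z => dx ⬝ᵥ z) h
  simp only [dotProduct_add, dotProduct_zero, dotProduct_mulVec, vecMul_transpose] at h1
  rw [← dotProduct_mulVec] at h1
  have h2 : 0 ≤ (E *ᵥ dx) ⬝ᵥ μ := Finset.sum_nonneg fun i _ => by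
    rw [mul_comm]; exact hμ i
  have h3 : 0 ≤ (C *ᵥ dx) ⬝ᵥ lam := Finset.sum_nonneg fun i _ => by
    rw [mul_comm]; exact hlam i
  rw [dotProduct_comm g, quadForm]
  linarith

namespace Problem

variable {n₁ n₂ m l₁ l₂ : ℕ} {P : Problem n₁ n₂ m l₁ l₂}

/-- Lagrange multipliers of the one-sided constraints from those of the two-sided ones. -/
def multipliersOfSigned (lam : Fin m ⊕ (Fin l₁ ⊕ Fin l₂) → ℝ) : Multipliers m l₁ l₂ where
  μ := lam ∘ Sum.inl
  αx := fun i => max (-lam (Sum.inr (Sum.inl i))) 0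
  γx := fun i => max (lam (Sum.inr (Sum.inl i))) 0
  αy := fun i => max (-lam (Sum.inr (Sum.inr i))) 0
  γy := fun i => max (lam (Sum.inr (Sum.inr i))) 0

theorem max_sub_max_neg (a : ℝ) : max a 0 - max (-a) 0 = a := by
  rcases le_total a 0 with h | h
  · rw [max_eq_right h, max_eq_left (by linarith)]; ring
  · rw [max_eq_left h, max_eq_right (by linarith)]; ring

theorem isKKT_of_boxKKT {x : Vec n₁} {y : Vec n₂} {lam : Fin m ⊕ (Fin l₁ ⊕ Fin l₂) → ℝ}
    (h : BoxKKT P.row P.lower P.upper P.stackedGrad (pair x y) lam) :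
    P.IsKKT x y (multipliersOfSigned lam) := by
  obtain ⟨hf, hs, hn⟩ := h
  rw [boxFeasible_iff] at hf
  rw [sum_smul_row] at hs
  have hsx := congrArg (fun z => (fstCLM n₁ n₂ z).ofLp) hs
  have hsy := congrArg (fun z => (sndCLM n₁ n₂ z).ofLp) hs
  simp only [map_add, stackedGrad, fstCLM_pair, sndCLM_pair, WithLp.ofLp_add, map_zero,
    WithLp.ofLp_zero, ← add_assoc] at hsx hsy
  refine ⟨?_, ?_, fun i => ?_, boxCompl_of_signed hf.2.1 fun i => ?_,
    boxCompl_of_signed hf.2.2 fun i => ?_⟩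
  · have e : (multipliersOfSigned lam).γx - (multipliersOfSigned lam).αx =
        lam ∘ Sum.inr ∘ Sum.inl := funext fun i => max_sub_max_neg _
    rw [e]
    exact hsx
  · have e : (multipliersOfSigned lam).γy - (multipliersOfSigned lam).αy =
        lam ∘ Sum.inr ∘ Sum.inr := funext fun i => max_sub_max_neg _
    rw [e]
    exact hsy
  · have h1 := hn (Sum.inl i)
    -- The lower bound of a coupling row is `⊥`, which a real value never attains, so its multiplier
    -- cannot be negative.
    have h2 : 0 ≤ lam (Sum.inl i) := by
      by_contra! h0
      simpa [lower] using h1.2 h0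
    refine ⟨h2, by simpa using hf.1 i, ?_⟩
    by_cases h0 : lam (Sum.inl i) = 0
    · simp [multipliersOfSigned, h0]
    · have := (P.boxActive_inl x y i).1 (hn.active h0)
      simp [this]
  · have h1 := hn (Sum.inr (Sum.inl i))
    rw [inner_row_pair] at h1
    exact h1
  · have h1 := hn (Sum.inr (Sum.inr i))
    rw [inner_row_pair] at h1
    exact h1

theorem SSOSC.pos {x : Vec n₁} {y : Vec n₂} {lam : Fin m ⊕ (Fin l₁ ⊕ Fin l₂) → ℝ}
    (h : P.SSOSC x y (multipliersOfSigned lam)) (w : EuclideanSpace ℝ (Fin n₁ ⊕ Fin n₂))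
    (hw : w ≠ 0) (hz : ∀ i, lam i ≠ 0 → inner ℝ (P.row i) w = 0) :
    0 < inner ℝ w (toEuclideanCLM (𝕜 := ℝ) (P.hessObj x y) w) := by
  rw [inner_toEuclideanCLM]
  refine h w.ofLp (fun h0 => hw (by ext i; simp [h0])) ?_
  have key : ∀ i, lam i ≠ 0 → P.fullMatrix i ⬝ᵥ w.ofLp = 0 := fun i hi => by
    have := hz i hi
    rwa [inner_row] at this
  have hmax : ∀ b : ℝ, 0 < max b 0 → b ≠ 0 := by
    rintro b hb rfl
    simp at hb
  funext i
  change P.rowsMatrix _ _ _ i ⬝ᵥ w.ofLp = 0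
  rw [rowsMatrix_apply]
  apply key
  rcases i with ⟨i, hi⟩ | ⟨i, hi⟩ | ⟨i, hi⟩
  · exact (Finset.mem_filter.1 hi).2.2.ne'
  · rcases (Finset.mem_filter.1 hi).2 with h1 | h1
    · exact neg_ne_zero.1 (hmax _ h1.2)
    · exact hmax _ h1.2
  · rcases (Finset.mem_filter.1 hi).2 with h1 | h1
    · exact neg_ne_zero.1 (hmax _ h1.2)
    · exact hmax _ h1.2

theorem StrictCompl.ne_zero {x : Vec n₁} {y : Vec n₂} {lam : Fin m ⊕ (Fin l₁ ⊕ Fin l₂) → ℝ}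
    (h : P.StrictCompl x y (multipliersOfSigned lam)) (i : Fin m ⊕ (Fin l₁ ⊕ Fin l₂))
    (hi : BoxActive P.row P.lower P.upper (pair x y) i) : lam i ≠ 0 := by
  have hmax : ∀ b : ℝ, 0 < max b 0 → b ≠ 0 := by
    rintro b hb rfl
    simp at hb
  obtain ⟨h1, h2, h3, h4, h5⟩ := h
  rcases i with i | i | i
  · exact (h1 i ((P.boxActive_inl x y i).1 hi)).ne'
  · rcases (Finset.mem_filter.1 ((P.boxActive_inr_inl x y i).1 hi)).2 with h0 | h0
    · exact neg_ne_zero.1 (hmax _ (h2 i h0))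
    · exact hmax _ (h3 i h0)
  · rcases (Finset.mem_filter.1 ((P.boxActive_inr_inr x y i).1 hi)).2 with h0 | h0
    · exact neg_ne_zero.1 (hmax _ (h4 i h0))
    · exact hmax _ (h5 i h0)

/-- Signed multipliers of the two-sided constraints; the two copies of the multiplier of the
coupling constraint are merged into their minimum, which is complementary at the trial point. -/
noncomputable def signedMultipliers (q : QOData n₁ n₂ m l₁ l₂) : Fin m ⊕ (Fin l₁ ⊕ Fin l₂) → ℝ :=
  Sum.elim (fun i => min (q.μx i) (q.μy i)) (Sum.elim (q.γx - q.αx) (q.γy - q.αy))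

/-- The residual of the joint stationarity condition at `q`. -/
noncomputable def residual (P : Problem n₁ n₂ m l₁ l₂) (x : Vec n₁) (y : Vec n₂)
    (Hx : Matrix (Fin n₁) (Fin n₁) ℝ)
    (Hy : Matrix (Fin n₂) (Fin n₂) ℝ) (q : QOData n₁ n₂ m l₁ l₂) :
    EuclideanSpace ℝ (Fin n₁ ⊕ Fin n₂) :=
  P.stackedGrad (pair x y) +
    toEuclideanCLM (𝕜 := ℝ) (Matrix.fromBlocks Hx 0 0 Hy) (pair (q.x - x) (q.y - y)) +
    ∑ i, signedMultipliers q i • P.row i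

/-- A bound for the effect of the multipliers of the coupling constraint on the residual. -/
noncomputable def couplingBound (P : Problem n₁ n₂ m l₁ l₂) : ℝ :=
  ∑ i, (‖pair (n₂ := n₂) (WithLp.toLp 2 (P.E i)) 0‖ + ‖pair (n₁ := n₁) 0 (WithLp.toLp 2 (P.F i))‖)

theorem couplingBound_nonneg : 0 ≤ P.couplingBound :=
  Finset.sum_nonneg fun _ _ => by positivity

/-- Subtracting each block's own stationarity condition leaves only the gaps between the minimum and
`μx`, respectively `μy`, and each gap is at most `|μx i - μy i|`. -/
theorem norm_residual_le {x : Vec n₁} {y : Vec n₂} {Hx : Matrix (Fin n₁) (Fin n₁) ℝ}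
    {Hy : Matrix (Fin n₂) (Fin n₂) ℝ} {q : QOData n₁ n₂ m l₁ l₂}
    (kx : (gradient P.f x).ofLp + Hx *ᵥ (q.x - x).ofLp
      + P.Eᵀ *ᵥ q.μx.ofLp + P.Cᵀ *ᵥ (q.γx - q.αx) = 0)
    (ky : (gradient P.θ y).ofLp + Hy *ᵥ (q.y - y).ofLp
      + P.Fᵀ *ᵥ q.μy.ofLp + P.Dᵀ *ᵥ (q.γy - q.αy) = 0) :
    ‖P.residual x y Hx Hy q‖ ≤ P.couplingBound * ‖q.μx - q.μy‖ := by
  have hr : P.residual x y Hx Hy q = ∑ i, ((min (q.μx i) (q.μy i) - q.μx i) •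
      pair (n₂ := n₂) (WithLp.toLp 2 (P.E i)) 0 + (min (q.μx i) (q.μy i) - q.μy i) •
      pair (n₁ := n₁) 0 (WithLp.toLp 2 (P.F i))) := by
    rw [residual, sum_smul_row, fromBlocks_mulVec_pair]
    ext j
    rcases j with j | j
    · have := congrFun kx j
      simp only [Pi.add_apply, Pi.zero_apply] at this
      simp [stackedGrad, signedMultipliers, mulVec, dotProduct, mul_sub, Finset.sum_sub_distrib,
        mul_comm, Function.comp_def] at this ⊢
      linarith
    · have := congrFun ky j
      simp only [Pi.add_apply, Pi.zero_apply] at this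
      simp [stackedGrad, signedMultipliers, mulVec, dotProduct, mul_sub, Finset.sum_sub_distrib,
        mul_comm, Function.comp_def] at this ⊢
      linarith
  have hμ : ∀ i, |q.μx i - q.μy i| ≤ ‖q.μx - q.μy‖ := fun i =>
    PiLp.norm_apply_le (q.μx - q.μy) i
  rw [hr, couplingBound, Finset.sum_mul]
  refine norm_sum_le_of_le _ fun i _ => ?_
  have h1 : |min (q.μx i) (q.μy i) - q.μx i| ≤ ‖q.μx - q.μy‖ := by
    refine le_trans ?_ (hμ i)
    rcases min_cases (q.μx i) (q.μy i) with ⟨h, -⟩ | ⟨h, -⟩ <;> rw [h]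
    · simp
    · rw [abs_sub_comm]
  have h2 : |min (q.μx i) (q.μy i) - q.μy i| ≤ ‖q.μx - q.μy‖ := by
    refine le_trans ?_ (hμ i)
    rcases min_cases (q.μx i) (q.μy i) with ⟨h, -⟩ | ⟨h, -⟩ <;> rw [h]
    simp
  refine (norm_add_le _ _).trans ?_
  rw [norm_smul, norm_smul, add_mul, Real.norm_eq_abs, Real.norm_eq_abs]
  rw [mul_comm ‖pair _ _‖, mul_comm ‖pair _ _‖]
  gcongr

/-! ### Feasibility, complementarity and descent for the subproblems -/

section Split

variable {x : Vec n₁} {y : Vec n₂} {Hx : Matrix (Fin n₁) (Fin n₁) ℝ}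
  {Hy : Matrix (Fin n₂) (Fin n₂) ℝ} {q : QOData n₁ n₂ m l₁ l₂}

theorem h_add_h (x x' : Vec n₁) (y y' : Vec n₂) (i : Fin m) :
    P.h x' y i + P.h x y' i - P.h x y i = P.h x' y' i := by
  simp only [h_apply]; ring

/-- As `h` is affine and separable, its value at the trial point is at most `h / 2 + h / 2 - h = 0`;
this is where `c = 1` matters. -/
theorem SolvesSplit.mem_feasible (h : P.SolvesSplit 1 x y Hx Hy q) : (q.x, q.y) ∈ P.feasible := by
  obtain ⟨⟨hxf, -⟩, ⟨hyf, -⟩, -⟩ := h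
  refine ⟨fun i => ?_, hxf.2, hyf.2⟩
  have h1 := hxf.1 i
  have h2 := hyf.1 i
  have h3 := P.h_add_h x q.x y q.y i
  change P.h q.x q.y i ≤ 0
  linarith

theorem boxNormal_signedMultipliers (hpos : ∀ i, 0 ≤ min (q.μx i) (q.μy i))
    (hS : ∀ i, 0 < min (q.μx i) (q.μy i) → P.h q.x q.y i = 0)
    (bx : BoxCompl P.l P.v (P.C *ᵥ q.x.ofLp) q.αx q.γx)
    (bt : BoxCompl P.s P.r (P.D *ᵥ q.y.ofLp) q.αy q.γy) :
    BoxNormal P.row P.lower P.upper (pair q.x q.y) (signedMultipliers q) := by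
  rintro (i | i | i) <;> rw [inner_row_pair]
  · refine ⟨fun hi => ?_, fun hi => absurd (hpos i) (not_le.2 hi)⟩
    have := hS i hi
    rw [h_apply, sub_eq_zero] at this
    exact congrArg _ this
  · exact ⟨fun hi => bx.eq_upper hi, fun hi => bx.eq_lower hi⟩
  · exact ⟨fun hi => bt.eq_upper hi, fun hi => bt.eq_lower hi⟩

/-- A positive minimum means that both coupling multipliers are positive. Both half-relaxed
constraints are then tight, and their sum makes the original constraint tight at the trial point. -/
theorem SolvesSplit.boxNormal (h : P.SolvesSplit 1 x y Hx Hy q) :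
    BoxNormal P.row P.lower P.upper (pair q.x q.y) (signedMultipliers q) := by
  obtain ⟨-, -, -, cx, bx, -, cy, bt⟩ := h
  refine boxNormal_signedMultipliers (fun i => le_min (cx i).1 (cy i).1) (fun i hi => ?_) bx bt
  have h1 := (mul_eq_zero.1 (cx i).2.2).resolve_left (hi.trans_le (min_le_left _ _)).ne'
  have h2 := (mul_eq_zero.1 (cy i).2.2).resolve_left (hi.trans_le (min_le_right _ _)).ne'
  simp only [Pi.sub_apply, Pi.smul_apply, smul_eq_mul] at h1 h2
  linarith [P.h_add_h x q.x y q.y i]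

/-- The inequality has no residual term because each block is tested with its own multiplier:
complementarity gives `μ i * (E dx) i = -(μ i * h i) / 2`, nonnegative at a feasible point, and
likewise for `y`. -/
theorem SolvesSplit.descent (h : P.SolvesSplit 1 x y Hx Hy q) (hf : (x, y) ∈ P.feasible) :
    inner ℝ (P.stackedGrad (pair x y)) (pair (q.x - x) (q.y - y)) ≤
      -(quadForm Hx (q.x - x).ofLp + quadForm Hy (q.y - y).ofLp) := by
  obtain ⟨-, -, kx, cx, bx, ky, cy, bt⟩ := h
  have hx : (gradient P.f x).ofLp ⬝ᵥ (q.x - x).ofLp ≤ -quadForm Hx (q.x - x).ofLp := by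
    refine dotProduct_le_neg_quadForm kx (fun i => ?_) (fun i => ?_)
    · obtain ⟨h1, -, h3⟩ := cx i
      have h4 : (P.E *ᵥ (q.x - x).ofLp) i = P.h q.x y i - P.h x y i := by
        simp only [h_apply, WithLp.ofLp_sub, mulVec_sub, Pi.sub_apply]; ring
      simp only [Pi.sub_apply, Pi.smul_apply, smul_eq_mul] at h3
      rw [h4]
      nlinarith [hf.1 i, mul_nonneg h1 (neg_nonneg.2 (hf.1 i))]
    · rw [WithLp.ofLp_sub, mulVec_sub]
      exact bx.mul_nonneg hf.2.1 i
  have hy : (gradient P.θ y).ofLp ⬝ᵥ (q.y - y).ofLp ≤ -quadForm Hy (q.y - y).ofLp := by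
    refine dotProduct_le_neg_quadForm ky (fun i => ?_) (fun i => ?_)
    · obtain ⟨h1, -, h3⟩ := cy i
      have h4 : (P.F *ᵥ (q.y - y).ofLp) i = P.h x q.y i - P.h x y i := by
        simp only [h_apply, WithLp.ofLp_sub, mulVec_sub, Pi.sub_apply]; ring
      simp only [Pi.sub_apply, Pi.smul_apply, smul_eq_mul] at h3
      rw [h4]
      nlinarith [hf.1 i, mul_nonneg h1 (neg_nonneg.2 (hf.1 i))]
    · rw [WithLp.ofLp_sub, mulVec_sub]
      exact bt.mul_nonneg hf.2.2 i
  rw [stackedGrad, fstCLM_pair, sndCLM_pair, inner_pair]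
  simp only [EuclideanSpace.inner_eq_star_dotProduct, star_trivial]
  rw [dotProduct_comm, dotProduct_comm (q.y - y).ofLp]
  linarith

theorem SolvesJoint.boxNormal (h : P.SolvesJoint x y Hx Hy q) :
    BoxNormal P.row P.lower P.upper (pair q.x q.y) (signedMultipliers q) := by
  obtain ⟨-, hμ, -, -, c, bx, bt⟩ := h
  refine boxNormal_signedMultipliers (fun i => ?_) (fun i hi => ?_) bx bt
  · rw [← hμ, min_self]; exact (c i).1
  · rw [← hμ, min_self] at hi
    simpa [hi.ne'] using (c i).2.2

theorem SolvesJoint.residual_eq_zero (h : P.SolvesJoint x y Hx Hy q) :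
    P.residual x y Hx Hy q = 0 := by
  obtain ⟨-, hμ, kx, ky, -⟩ := h
  rw [hμ] at ky
  have := norm_residual_le kx ky
  rwa [hμ, sub_self, norm_zero, mul_zero, norm_le_zero_iff] at this

theorem inner_toEuclideanCLM_fromBlocks (dx : Vec n₁) (dy : Vec n₂) :
    inner ℝ (pair dx dy) (toEuclideanCLM (𝕜 := ℝ) (Matrix.fromBlocks Hx 0 0 Hy) (pair dx dy)) =
      quadForm Hx dx.ofLp + quadForm Hy dy.ofLp := by
  rw [fromBlocks_mulVec_pair, inner_pair, inner_toEuclideanCLM, inner_toEuclideanCLM]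
  rfl

theorem SolvesJoint.descent (h : P.SolvesJoint x y Hx Hy q) (hf : (x, y) ∈ P.feasible) :
    inner ℝ (P.stackedGrad (pair x y)) (pair (q.x - x) (q.y - y)) ≤
      -(quadForm Hx (q.x - x).ofLp + quadForm Hy (q.y - y).ofLp) := by
  have h1 := congrArg (fun z => inner ℝ (pair (q.x - x) (q.y - y)) z) h.residual_eq_zero
  simp only [residual, inner_add_right, inner_sum, inner_smul_right, inner_zero_right,
    inner_toEuclideanCLM_fromBlocks] at h1
  have h2 : 0 ≤ ∑ i, signedMultipliers q i * inner ℝ (pair (q.x - x) (q.y - y)) (P.row i) :=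
    Finset.sum_nonneg fun i _ => by
      have h3 := h.boxNormal.mul_nonneg ((P.boxFeasible_iff x y).2 hf) i
      rwa [← pair_add_pair_sub x q.x y q.y, add_sub_cancel_left, real_inner_comm] at h3
  rw [real_inner_comm]
  linarith

end Split

end Problem

/-! ### The run as an instance of the abstract method -/

theorem exists_norm_toEuclideanCLM_le {κ : Type*} [Fintype κ] [DecidableEq κ] (B : ℝ) :
    ∃ C : ℝ, ∀ A : Matrix κ κ ℝ, (∀ i j, |A i j| ≤ B) → ‖toEuclideanCLM (𝕜 := ℝ) A‖ ≤ C := by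
  refine ⟨∑ i, ∑ j, B * ‖toEuclideanCLM (𝕜 := ℝ) (Matrix.single i j (1 : ℝ) : Matrix κ κ ℝ)‖,
    fun A hA => ?_⟩
  conv_lhs => rw [matrix_eq_sum_single A]
  simp only [map_sum]
  refine norm_sum_le_of_le _ fun i _ => norm_sum_le_of_le _ fun j _ => ?_
  have h1 : Matrix.single i j (A i j) = A i j • Matrix.single i j (1 : ℝ) := by simp
  rw [h1, map_smul, norm_smul]
  exact mul_le_mul_of_nonneg_right (hA i j) (norm_nonneg _)

namespace Run

variable {n₁ n₂ m l₁ l₂ : ℕ} {P : Problem n₁ n₂ m l₁ l₂} {p : Params} (R : Run P p)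

section

variable (hc : p.c = 1)
include hc

theorem trial_mem_feasible (k : ℕ) : ((R.sol k).x, (R.sol k).y) ∈ P.feasible := by
  by_cases h : p.Accepts (R.x k) (R.y k) (R.trial k)
  · rw [R.sol_of_accepts k h]
    have := R.trial_spec k
    rw [hc] at this
    exact this.mem_feasible
  · exact (R.sol_of_not_accepts k h).1.1

theorem boxNormal (k : ℕ) : BoxNormal P.row P.lower P.upper (pair (R.sol k).x (R.sol k).y)
    (Problem.signedMultipliers (R.sol k)) := by
  by_cases h : p.Accepts (R.x k) (R.y k) (R.trial k)
  · rw [R.sol_of_accepts k h]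
    have := R.trial_spec k
    rw [hc] at this
    exact this.boxNormal
  · exact (R.sol_of_not_accepts k h).boxNormal

theorem norm_residual_le (k : ℕ) :
    ‖P.residual (R.x k) (R.y k) (R.Hx k) (R.Hy k) (R.sol k)‖ ≤
      P.couplingBound * p.M₁ * ‖R.dir k‖ ^ p.τ₁ := by
  by_cases h : p.Accepts (R.x k) (R.y k) (R.trial k)
  · have hs := R.trial_spec k
    rw [hc, ← R.sol_of_accepts k h] at hs
    obtain ⟨-, -, kx, -, -, ky, -⟩ := hs
    refine (Problem.norm_residual_le kx ky).trans ?_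
    rw [mul_assoc]
    refine mul_le_mul_of_nonneg_left ?_ Problem.couplingBound_nonneg
    rw [← R.sol_of_accepts k h] at h
    exact h.2
  · rw [(R.sol_of_not_accepts k h).residual_eq_zero, norm_zero]
    have := P.couplingBound_nonneg
    have := p.M₁_pos
    positivity

theorem descent (k : ℕ) (hf : (R.x k, R.y k) ∈ P.feasible) :
    inner ℝ (P.stackedGrad (R.u k)) (R.dir k) ≤
      -(quadForm (R.Hx k) ((R.sol k).x - R.x k).ofLp +
        quadForm (R.Hy k) ((R.sol k).y - R.y k).ofLp) := by
  by_cases h : p.Accepts (R.x k) (R.y k) (R.trial k)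
  · have hs := R.trial_spec k
    rw [hc, ← R.sol_of_accepts k h] at hs
    exact hs.descent hf
  · exact (R.sol_of_not_accepts k h).descent hf

theorem step_isGreatest (k : ℕ) : IsGreatest {t : ℝ | (∃ i : ℕ, t = p.σ ^ i) ∧
    P.stackedObj (R.u k + t • R.dir k) ≤ P.stackedObj (R.u k) - p.ρ * t *
      inner ℝ (R.dir k) (toEuclideanCLM (𝕜 := ℝ) (R.H k) (R.dir k))} (R.t k) := by
  have h := R.step_spec k
  have h1 : 1 / (2 - p.c) = 1 := by rw [hc]; norm_num
  rw [h1] at h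
  simp only [ite_self, one_mul] at h
  simp only [dir, u, H, Problem.inner_toEuclideanCLM_fromBlocks, pair_add_smul,
    Problem.stackedObj, fstCLM_pair, sndCLM_pair]
  exact h

end

theorem u_add_dir (k : ℕ) : R.u k + R.dir k = pair (R.sol k).x (R.sol k).y :=
  pair_add_pair_sub _ _ _ _

theorem u_succ (k : ℕ) : R.u (k + 1) = R.u k + R.t k • R.dir k := by
  rw [u, u, dir, pair_add_smul, R.x_succ, R.y_succ]

theorem t_pos_le_one (hc : p.c = 1) (k : ℕ) : 0 < R.t k ∧ R.t k ≤ 1 := by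
  obtain ⟨⟨i, hi⟩, -⟩ := (R.step_isGreatest hc k).1
  rw [hi]
  exact ⟨pow_pos p.σ_mem.1 i, pow_le_one₀ p.σ_mem.1.le p.σ_mem.2.le⟩

theorem boxFeasible_u (hc : p.c = 1) (k : ℕ) : BoxFeasible P.row P.lower P.upper (R.u k) := by
  induction k with
  | zero => exact (P.boxFeasible_iff _ _).2 R.init_feasible
  | succ k ih =>
    rw [u_succ]
    refine ih.lineSegment ?_ (R.t_pos_le_one hc k).1.le (R.t_pos_le_one hc k).2
    rw [u_add_dir]
    exact (P.boxFeasible_iff _ _).2 (R.trial_mem_feasible hc k)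

/-- The run as an abstract feasible sequential quadratic method. -/
noncomputable def toBoxSQO (hc : p.c = 1) (hρ : p.ρ < 1 / 2) (hτ : 1 < p.τ₁)
    (hpd : R.UniformlyPosDef) (hbdd : Bornology.IsBounded (Set.range R.u)) :
    BoxSQO P.row P.lower P.upper P.stackedObj P.stackedGrad where
  u := R.u
  d := R.dir
  H := fun k => toEuclideanCLM (𝕜 := ℝ) (R.H k)
  t := R.t
  lam := fun k => Problem.signedMultipliers (R.sol k)
  r := fun k => P.residual (R.x k) (R.y k) (R.Hx k) (R.Hy k) (R.sol k)
  ρ := p.ρ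
  σ := p.σ
  η := hpd.1.choose
  K := P.couplingBound * p.M₁
  τ := p.τ₁
  ρ_pos := p.ρ_mem.1
  ρ_lt := hρ
  σ_pos := p.σ_mem.1
  η_pos := hpd.1.choose_spec.1
  one_lt_τ := hτ
  feasible_u := R.boxFeasible_u hc
  feasible_trial := fun k => by
    rw [u_add_dir]
    exact (P.boxFeasible_iff _ _).2 (R.trial_mem_feasible hc k)
  coercive := fun k z => by
    have h := (hpd.1.choose_spec.2 k).dotProduct_mulVec_nonneg z.ofLp
    rw [inner_toEuclideanCLM, EuclideanSpace.real_norm_sq_eq]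
    simp only [star_trivial, sub_mulVec, smul_mulVec, one_mulVec, dotProduct_sub,
      dotProduct_smul, smul_eq_mul] at h
    simp only [dotProduct, ← pow_two] at h ⊢
    linarith
  kkt := fun k => rfl
  normal := fun k => by
    rw [u_add_dir]
    exact R.boxNormal hc k
  residual := R.norm_residual_le hc
  descent := fun k => by
    have h := R.descent hc k ((P.boxFeasible_iff _ _).1 (R.boxFeasible_u hc k))
    rw [dir, H, Problem.inner_toEuclideanCLM_fromBlocks]
    exact h
  t_pos := fun k => (R.t_pos_le_one hc k).1
  t_le_one := fun k => (R.t_pos_le_one hc k).2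
  armijo := fun k => (R.step_isGreatest hc k).1.2
  full_step := fun k h => le_antisymm (R.t_pos_le_one hc k).2
    ((R.step_isGreatest hc k).2 ⟨⟨0, (pow_zero _).symm⟩, by simpa using h⟩)
  backtrack := fun k h => by
    obtain ⟨⟨i, hi⟩, -⟩ := (R.step_isGreatest hc k).1
    rcases i with - | i
    · exact absurd (hi.trans (pow_zero _)) h
    have hdiv : R.t k / p.σ = p.σ ^ i := by
      rw [hi, pow_succ, mul_div_cancel_right₀ _ p.σ_mem.1.ne']
    refine ⟨hdiv ▸ pow_le_one₀ p.σ_mem.1.le p.σ_mem.2.le, ?_⟩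
    -- The step `t / σ` was tried just before `t`; were it acceptable, `t` would not be the largest
    -- acceptable step.
    by_contra! hle
    have h1 := (R.step_isGreatest hc k).2 ⟨⟨i, hdiv⟩, hle⟩
    have h2 := (R.t_pos_le_one hc k).1
    rw [div_le_iff₀ p.σ_mem.1] at h1
    nlinarith [p.σ_mem.2]
  succ := R.u_succ
  bounded := hbdd
  H_bounded := by
    obtain ⟨B, hB⟩ := hpd.2 Set.univ (by rwa [Set.image_univ])
    obtain ⟨C, hC⟩ := exists_norm_toEuclideanCLM_le (κ := Fin n₁ ⊕ Fin n₂) B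
    exact ⟨C, fun k => hC _ (hB k (Set.mem_univ k))⟩

/-- The set of all rows of the working matrix. -/
def workRows (k : ℕ) : Set (Fin m ⊕ (Fin l₁ ⊕ Fin l₂)) :=
  Set.range (Problem.inclRows (R.workS k) (P.actI (R.sol k).x) (P.actJ (R.sol k).y))

theorem active_of_mem_workRows (hc : p.c = 1) (k : ℕ) {i : Fin m ⊕ (Fin l₁ ⊕ Fin l₂)}
    (hi : i ∈ R.workRows k) : BoxActive P.row P.lower P.upper (R.u k + R.dir k) i := by
  rw [u_add_dir]
  obtain ⟨⟨i, hi⟩ | ⟨i, hi⟩ | ⟨i, hi⟩, rfl⟩ := hi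
  · refine (P.boxActive_inl _ _ i).2 ?_
    unfold workS at hi
    split_ifs at hi
    · obtain ⟨-, h1, h2⟩ := Finset.mem_filter.1 hi
      rw [hc] at h1 h2
      linarith [P.h_add_h (R.x k) (R.sol k).x (R.y k) (R.sol k).y i]
    · exact (Finset.mem_filter.1 hi).2
  · exact (P.boxActive_inr_inl _ _ i).2 hi
  · exact (P.boxActive_inr_inr _ _ i).2 hi

/-- By its form, `e - P_k e` is `B_kᵀ` applied to some vector. Invertibility of `B_k B_kᵀ` plays no
role. -/
theorem sub_proj_mem_span (k : ℕ) (e : Fin n₁ ⊕ Fin n₂ → ℝ) :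
    WithLp.toLp 2 e - WithLp.toLp 2 (R.proj k *ᵥ e) ∈
      Submodule.span ℝ (P.row '' R.workRows k) := by
  classical
  obtain ⟨b, hb⟩ : ∃ b, e - R.proj k *ᵥ e = (R.B k)ᵀ *ᵥ b := by
    refine ⟨((R.B k * (R.B k)ᵀ)⁻¹ * R.B k) *ᵥ e, ?_⟩
    rw [proj, sub_mulVec, one_mulVec, sub_sub_cancel, mulVec_mulVec, Matrix.mul_assoc]
  rw [← WithLp.toLp_sub, hb]
  have h1 : WithLp.toLp 2 ((R.B k)ᵀ *ᵥ b) = ∑ i, b i • P.row (Problem.inclRows _ _ _ i) := by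
    ext j
    simp only [mulVec, dotProduct, transpose_apply, WithLp.ofLp_sum, WithLp.ofLp_smul,
      Finset.sum_apply, Pi.smul_apply, smul_eq_mul, Problem.row, ← Problem.rowsMatrix_apply]
    exact Finset.sum_congr rfl fun i _ => mul_comm _ _
  rw [h1]
  exact Submodule.sum_mem _ fun i _ => Submodule.smul_mem _ _
    (Submodule.subset_span ⟨_, ⟨i, rfl⟩, rfl⟩)

end Run

/-! ### Proof of the theorem -/

theorem theorem6 {n₁ n₂ m l₁ l₂ : ℕ} (P : Problem n₁ n₂ m l₁ l₂) (p : Params)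
    (hc : p.c = 1) (hρ : p.ρ ∈ Set.Ioo (0 : ℝ) (1 / 2)) (hτ : 1 < p.τ₁)
    (R : Run P p)
    (hpd : R.UniformlyPosDef)
    (hC2 : P.C2NearFeasible)
    (hbdd : Bornology.IsBounded (Set.range R.u))
    (xs : Vec n₁) (ys : Vec n₂)
    (hacc : MapClusterPt (pair xs ys) atTop R.u)
    (hLICQ : P.LICQ xs ys)
    (hSSOSC : ∀ Λ, P.IsKKT xs ys Λ → P.SSOSC xs ys Λ)
    (hDM : R.DennisMore xs ys) :
    Tendsto R.u atTop (𝓝 (pair xs ys)) ∧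
      (fun k => R.u (k + 1) - pair xs ys) =o[atTop] (fun k => R.u k - pair xs ys) := by
  let S := R.toBoxSQO hc hρ.2 hτ hpd hbdd
  have hG := P.hasGradientAt_stackedObj
  have hGc := P.continuous_stackedGrad
  have hfeas : (xs, ys) ∈ P.feasible := by
    obtain ⟨φ, -, hφ⟩ := hacc.tendsto_subseq
    exact (P.boxFeasible_iff xs ys).1 (BoxFeasible.of_tendsto hφ fun k => S.feasible_u _)
  obtain ⟨hf, hθ⟩ := P.contDiffAt_of_feasible hC2 hfeas
  have hQ := P.hasStrictFDerivAt_stackedGrad hf hθ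
  have hli := hLICQ.linearIndependent
  have hpos : ∀ lam, BoxKKT P.row P.lower P.upper P.stackedGrad (pair xs ys) lam → ∀ w, w ≠ 0 →
      (∀ i, lam i ≠ 0 → inner ℝ (P.row i) w = 0) →
      0 < inner ℝ w (toEuclideanCLM (𝕜 := ℝ) (P.hessObj xs ys) w) :=
    fun lam hlam => (hSSOSC _ (Problem.isKKT_of_boxKKT hlam)).pos
  have hu : Tendsto R.u atTop (𝓝 (pair xs ys)) :=
    S.tendsto_of_secondOrder hG hGc hQ hacc hli hpos
  refine ⟨hu, ?_⟩
  -- replacing the Hessian at the iterate by the one at the limit costs only `o(‖d_k‖)`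
  set Q := toEuclideanCLM (𝕜 := ℝ) (P.hessObj xs ys) with hQdef
  let Qk : ℕ → _ := fun k => toEuclideanCLM (𝕜 := ℝ) (P.hessObj (R.x k) (R.y k))
  have hshift : (fun k => (Qk k - Q) (R.dir k)) =o[atTop] R.dir := by
    have h1 : Tendsto (fun k => ‖Qk k - Q‖) atTop (𝓝 0) :=
      tendsto_iff_norm_sub_tendsto_zero.1 (P.tendsto_hessObj hf hθ hu)
    rw [Asymptotics.isLittleO_iff]
    intro ε hε
    filter_upwards [h1.eventually_lt_const hε] with k hk
    exact (Qk k - Q).le_of_opNorm_le hk.le _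
  have herr : ∀ k, toEuclideanCLM (𝕜 := ℝ) (R.H k) (R.dir k) - Q (R.dir k) =
      WithLp.toLp 2 (R.hessErr k) + (Qk k - Q) (R.dir k) := by
    intro k
    have : WithLp.toLp 2 (R.hessErr k) =
        toEuclideanCLM (𝕜 := ℝ) (R.H k) (R.dir k) - Qk k (R.dir k) := by
      rw [Run.hessErr, sub_mulVec, WithLp.toLp_sub]
      rfl
    rw [this, _root_.sub_apply]
    abel
  rcases hDM with h | ⟨h, hstrict⟩
  -- The unprojected condition is the case of an empty working set: the span is zero and `p` is the
  -- whole Hessian error.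
  · refine S.superlinear hG hGc hQ hu hli hpos (W := fun _ => ∅) (by simp) (fun k => ?_)
      (h.add hshift) (Or.inl fun _ => rfl)
    have h1 := herr k
    rw [Set.image_empty, Submodule.span_empty, Submodule.mem_bot, sub_eq_zero]
    exact h1
  · refine S.superlinear hG hGc hQ hu hli hpos (W := R.workRows)
      (fun k i hi => R.active_of_mem_workRows hc k hi) (fun k => ?_)
      (h.add hshift) (Or.inr fun lam hlam i hi =>
        (hstrict _ (Problem.isKKT_of_boxKKT hlam)).ne_zero i hi)
    have h1 := herr k
    change toEuclideanCLM (𝕜 := ℝ) (R.H k) (R.dir k) - Q (R.dir k) - _ ∈ _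
    rw [h1, add_sub_add_right_eq_sub]
    exact R.sub_proj_mem_span k _
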